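/- Let $q=p^m$ be a prime power ($p$ prime, $m\ge 1$), let $\mathbb{F}_q$ be the field with $q$ elements, and let $PG(2,\mathbb{F}_q)$ be the projective plane whose points are the one-dimensional subspaces of $\mathbb{F}_q^3$, whose lines are the two-dimensional subspaces, and in which incidence is inclusion. Then there is a finite connected $q$-dimensional simplicial complex $X_q$ such that: 1. the fundamental group of the geometric realization $|X_q|$ (at any base point) is isomorphic to $\mathbb{Z}^q$; 2. $X_q$ has exactly $q^2+q+1$ vertices; 3. the set of facets (inclusion-maximal faces) of $X_q$ is the disjoint union of two sets $\mathcal{L}_1,\mathcal{L}_2$ of $q^2+q+1$ facets each, and each $\mathcal{L}_i$ is a copy of $PG(2,\mathbb{F}_q)$: there are a bijection from the points of $PG(2,\mathbb{F}_q)$ to the vertices of $X_q$ and a bijection from its lines to $\mathcal{L}_i$ such that a point lies on a line if and only if the corresponding vertex belongs to the corresponding facet; moreover every face of $X_q$ is contained in a facet; 4. the cyclic group $\mathbb{Z}_{q^2+q+1}$ acts freely on $X_q$ by simplicial automorphisms, that is, no nonidentity element fixes a vertex, or even any point of $|X_q|$; 5. $X_q$ is 2-neighborly: any two distinct vertices form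 an edge. -/

import Mathlib

/-- The points of `PG(2, K)`: the one-dimensional subspaces of `K³`. -/
abbrev PGPoint (K : Type*) [Field K] : Type _ :=
  {U : Submodule K (Fin 3 → K) // Module.finrank K U = 1}

/-- The lines of `PG(2, K)`: the two-dimensional subspaces of `K³`.  A point `p` lies on a
line `l` when `p.1 ≤ l.1`. -/
abbrev PGLine (K : Type*) [Field K] : Type _ :=
  {U : Submodule K (Fin 3 → K) // Module.finrank K U = 2}

namespace AbstractSimplicialComplex

/-- The geometric realization of a simplicial complex with finite vertex set `V`: the points of
the standard simplex on `V` (with the topology of `ℝ^V`) whose support is contained in a face. -/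
def realization {V : Type*} [Fintype V] (X : AbstractSimplicialComplex V) : Set (V → ℝ) :=
  {x | x ∈ stdSimplex ℝ V ∧ ∃ s ∈ X.faces, Function.support x ⊆ (s : Set V)}

/-- The facets are the inclusion-maximal faces. -/
def facets {V : Type*} (X : AbstractSimplicialComplex V) : Set (Finset V) :=
  {s | Maximal (fun t => t ∈ X.faces) s}

/-- `X` has dimension `d`: the largest faces have `d + 1` vertices. -/
def HasDimension {V : Type*} (X : AbstractSimplicialComplex V) (d : ℕ) : Prop :=
  (∀ s ∈ X.faces, s.card ≤ d + 1) ∧ ∃ s ∈ X.faces, s.card = d + 1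

open Classical in
/-- `X` is 2-neighborly: every pair of distinct vertices is an edge. -/
def TwoNeighborly {V : Type*} (X : AbstractSimplicialComplex V) : Prop :=
  ∀ u v : V, u ≠ v → ({u, v} : Finset V) ∈ X.faces

/-- The set `𝓛` of vertex sets is a copy of `PG(2, K)` on the vertices of `X`: the points of
`PG(2, K)` correspond to the vertices and its lines to the members of `𝓛`, in such a way that
incidence becomes membership. -/
def IsCopyOfPG {V : Type*} (_X : AbstractSimplicialComplex V) (K : Type*) [Field K]
    (𝓛 : Set (Finset V)) : Prop :=
  ∃ (e : PGPoint K ≃ V) (f : PGLine K ≃ 𝓛),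
    ∀ (p : PGPoint K) (l : PGLine K), p.1 ≤ l.1 ↔ e p ∈ (f l : Finset V)

/-- The group of simplicial automorphisms of `X`, as permutations of the vertices. -/
def aut {V : Type*} (X : AbstractSimplicialComplex V) : Subgroup (Equiv.Perm V) where
  carrier := {σ | ∀ s : Finset V, s.map σ.toEmbedding ∈ X.faces ↔ s ∈ X.faces}
  one_mem' := fun s => by
    have h : s.map (1 : Equiv.Perm V).toEmbedding = s := by
      ext; simp [Finset.mem_map_equiv]; rfl
    rw [h]
  mul_mem' := fun {σ τ} hσ hτ s => by
    have h : s.map (σ * τ).toEmbedding = (s.map τ.toEmbedding).map σ.toEmbedding := by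
      rw [Finset.map_map]; rfl
    rw [h, hσ, hτ]
  inv_mem' := fun {σ} hσ s => by
    have h : (s.map (σ⁻¹).toEmbedding).map σ.toEmbedding = s := by
      rw [Finset.map_map]; ext; simp
    rw [← hσ, h]

/-- The action of the automorphism group on the geometric realization, extending the action on
the vertices linearly over every face. -/
instance {V : Type*} [Fintype V] (X : AbstractSimplicialComplex V) :
    MulAction X.aut X.realization where
  smul σ x := ⟨fun v => x.1 ((σ : Equiv.Perm V)⁻¹ v), by
    obtain ⟨⟨h0, h1⟩, s, hs, hsupp⟩ := x.2
    refine ⟨⟨fun v => h0 _, ?_⟩, s.map (σ : Equiv.Perm V).toEmbedding, (σ.2 s).2 hs, ?_⟩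
    · rw [← h1]
      exact Equiv.sum_comp (σ : Equiv.Perm V)⁻¹ x.1
    · intro v hv
      have := hsupp (show (σ : Equiv.Perm V)⁻¹ v ∈ Function.support x.1 from hv)
      simpa [Finset.mem_map_equiv] using this⟩
  one_smul x := rfl
  mul_smul σ τ x := by
    apply Subtype.ext
    funext v
    change x.1 ((σ.1 * τ.1)⁻¹ v) = x.1 (τ.1⁻¹ (σ.1⁻¹ v))
    simp [mul_inv_rev]

/-- The action of `G` on `X` given by `ρ` is free: no nonidentity element fixes a vertex, or even
a point of the geometric realization. -/
def ActsFreely {V : Type*} [Fintype V] (X : AbstractSimplicialComplex V) {G : Type*} [Group G]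
    (ρ : G →* X.aut) : Prop :=
  (∀ g : G, g ≠ 1 → ∀ v : V, (ρ g : Equiv.Perm V) v ≠ v) ∧
    ∀ g : G, g ≠ 1 → ∀ x : X.realization, ρ g • x ≠ x

end AbstractSimplicialComplex

/-! Let `L` be a cubic extension of `K`. The cyclic group G = Lˣ/Kˣ, of order q² + q + 1, acts
regularly on the points of the plane of `L`. Labelling points by G turns the lines into the
translates of one set D = {d 0, …, d q}, in which every nonzero element of G is a difference of
exactly one ordered pair (`isPerfectDifference_valueSet`, `exists_perfectDifference_PG`). The facets
of the complex are the translates of D and of -D. Translates within one family share at most one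
vertex, and a translate of D shares at most two with a translate of -D. The combinatorial claims
follow from this and from all facets having q + 1 ≥ 3 vertices.

For the fundamental group, every path between vertices is homotopic to an edge path (`isEdgePath`),
and every edge has a difference d i - d j. Triangles in translates of D and in translates of -D give
the same composition rule for such steps, in opposite orders (`stepPerm_mul`, `stepPerm_mul'`). So
the steps of difference d i - d 0 commute, and ℤ^q acts transitively on the path classes that start
at the vertex 0.

The action is free because of winding numbers. The i-th barycentric coordinate modulo 1 on
translates of D, and its opposite on translates of -D, agree on overlaps precisely because facets
meet in so few vertices. The resulting maps to the circle have winding numbers that recover the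
lattice vector (`exists_latticeAction_eq`, `windings_injective`). Loops correspond to the kernel of
ℤ^q → G, a ↦ ∑ a i (d i - d 0), which has finite index and is therefore again isomorphic to ℤ^q. -/

/-! ### Paths in subsets of a topological vector space -/

section Line

variable {E : Type*} [AddCommGroup E] [Module ℝ E] [TopologicalSpace E] [IsTopologicalAddGroup E]
  [ContinuousSMul ℝ E]

/-- The straight path between two points of a set that contains the segment joining them. -/
def Path.line {T : Set E} (x y : T) (h : segment ℝ (x : E) y ⊆ T) : Path x y where
  toFun t := ⟨AffineMap.lineMap (x : E) (y : E) (t : ℝ),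
    h (by rw [segment_eq_image_lineMap]; exact ⟨t, t.2, rfl⟩)⟩
  continuous_toFun := by
    refine Continuous.subtype_mk ?_ _
    simp only [AffineMap.lineMap_apply_module]
    fun_prop
  source' := by simp
  target' := by simp

theorem Path.coe_line_apply {T : Set E} (x y : T) (h : segment ℝ (x : E) y ⊆ T) (t : unitInterval) :
    (Path.line x y h t : E) = AffineMap.lineMap (x : E) (y : E) (t : ℝ) := rfl

theorem Path.line_mem {S T : Set E} (x y : T) (h : segment ℝ (x : E) y ⊆ T)
    (hS : segment ℝ (x : E) y ⊆ S) (t : unitInterval) : (Path.line x y h t : E) ∈ S :=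
  hS (by rw [segment_eq_image_lineMap]; exact ⟨t, t.2, rfl⟩)

theorem Path.line_self {T : Set E} (x : T) (h : segment ℝ (x : E) x ⊆ T) :
    Path.line x x h = Path.refl x := by
  ext t
  simp [Path.coe_line_apply]

/-- Two paths with the same endpoints that run in a star convex set are homotopic. -/
theorem StarConvex.homotopic {S T : Set E} (hST : S ⊆ T) {c : E} (hS : StarConvex ℝ c S) {x y : T}
    (p p' : Path x y) (hp : ∀ t, (p t : E) ∈ S) (hp' : ∀ t, (p' t : E) ∈ S) : p.Homotopic p' := by
  have : ContractibleSpace S := hS.contractibleSpace ⟨_, hp 0⟩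
  have hx : (x : E) ∈ S := by simpa using hp 0
  have hy : (y : E) ∈ S := by simpa using hp 1
  let lift (r : Path x y) (hr : ∀ t, (r t : E) ∈ S) : Path (⟨x, hx⟩ : S) ⟨y, hy⟩ :=
    { toFun := fun t => ⟨r t, hr t⟩
      continuous_toFun := by fun_prop
      source' := by simp
      target' := by simp }
  exact (SimplyConnectedSpace.paths_homotopic (lift p hp) (lift p' hp')).map
    ⟨Set.inclusion hST, continuous_inclusion hST⟩

theorem Path.trans_mem {Z : Type*} [TopologicalSpace Z] {S : Set Z} {x y z : Z} {p : Path x y}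
    {p' : Path y z} (hp : ∀ t, p t ∈ S) (hp' : ∀ t, p' t ∈ S) (t : unitInterval) :
    p.trans p' t ∈ S := by
  rw [Path.trans_apply]
  split_ifs
  exacts [hp _, hp' _]

end Line

/-! ### Edge paths in the geometric realization -/

namespace AbstractSimplicialComplex

theorem pair_mem_faces {V : Type*} [DecidableEq V] {X : AbstractSimplicialComplex V} {s : Finset V} (hs : s ∈ X.faces) {u v : V} (hu : u ∈ s) (hv : v ∈ s) :
    {u, v} ∈ X.faces :=
  (X.isRelLowerSet_faces hs).2 (by intro x hx; simp at hx; rcases hx with rfl | rfl <;> assumption)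
    (by simp)

variable {V : Type*} [Fintype V] (X : AbstractSimplicialComplex V)

/-- The closed face spanned by `s`, as a set of barycentric coordinates. -/
def closedFace (_ : AbstractSimplicialComplex V) (s : Finset V) : Set (V → ℝ) :=
  {x | x ∈ stdSimplex ℝ V ∧ Function.support x ⊆ (s : Set V)}

/-- The open star of a vertex. -/
def openStar (v : V) : Set (V → ℝ) := {x | x ∈ X.realization ∧ 0 < x v}

variable {X}

theorem closedFace_subset {s : Finset V} (hs : s ∈ X.faces) :
    X.closedFace s ⊆ X.realization := fun _ hx => ⟨hx.1, s, hs, hx.2⟩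

theorem convex_closedFace (s : Finset V) : Convex ℝ (X.closedFace s) := by
  intro x hx y hy a b ha hb hab
  refine ⟨convex_stdSimplex ℝ V hx.1 hy.1 ha hb hab, fun v hv => ?_⟩
  by_contra hvs
  have h1 : x v = 0 := by by_contra h; exact hvs (hx.2 h)
  have h2 : y v = 0 := by by_contra h; exact hvs (hy.2 h)
  simp [h1, h2] at hv

theorem openStar_subset (v : V) : X.openStar v ⊆ X.realization := fun _ h => h.1

theorem mem_face_of_mem_openStar {s : Finset V} {v : V} {x : V → ℝ} (hx : x ∈ X.openStar v)
    (hs : Function.support x ⊆ (s : Set V)) : v ∈ s := hs hx.2.ne'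

theorem exists_mem_openStar (x : X.realization) : ∃ v, (x : V → ℝ) ∈ X.openStar v := by
  by_contra! h
  have h0 : ∀ v, (x : V → ℝ) v ≤ 0 := fun v => not_lt.1 fun hv => h v ⟨x.2, hv⟩
  have := x.2.1.2
  have h1 := Finset.sum_nonpos (s := Finset.univ) fun v _ => h0 v
  linarith

theorem isOpen_openStar (v : V) : IsOpen {x : X.realization | (x : V → ℝ) ∈ X.openStar v} := by
  have : {x : X.realization | (x : V → ℝ) ∈ X.openStar v} =
      {x : X.realization | 0 < (x : V → ℝ) v} := by
    ext x; exact ⟨fun h => h.2, fun h => ⟨x.2, h⟩⟩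
  rw [this]
  exact isOpen_lt continuous_const ((continuous_apply v).comp continuous_subtype_val)

/-- Paths with the same endpoints in a closed face are homotopic. -/
theorem homotopic_of_closedFace {s : Finset V} (hs : s ∈ X.faces) {x y : X.realization}
    (p p' : Path x y) (hp : ∀ t, (p t : V → ℝ) ∈ X.closedFace s)
    (hp' : ∀ t, (p' t : V → ℝ) ∈ X.closedFace s) : p.Homotopic p' :=
  StarConvex.homotopic (closedFace_subset hs) ((convex_closedFace s).starConvex (hp 0)) p p' hp hp'

variable [DecidableEq V]

variable (X) in
/-- A vertex, as a point of the geometric realization. -/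
def vertex (v : V) : X.realization :=
  ⟨Pi.single v 1, single_mem_stdSimplex ℝ v, {v}, X.singleton_mem v, by
    simp⟩

theorem vertex_mem_closedFace {s : Finset V} {v : V} (hv : v ∈ s) :
    (X.vertex v : V → ℝ) ∈ X.closedFace s :=
  ⟨single_mem_stdSimplex ℝ v, Pi.support_single_subset.trans (by simpa using hv)⟩

theorem vertex_mem_openStar (v : V) : (X.vertex v : V → ℝ) ∈ X.openStar v :=
  ⟨(X.vertex v).2, by simp [vertex]⟩

/-- A point with positive `v`-coordinate lies in a closed face that contains `v`. The segment to `v`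
stays in that face, and its `v`-coordinate stays positive. -/
theorem starConvex_openStar (v : V) : StarConvex ℝ (X.vertex v : V → ℝ) (X.openStar v) := by
  rintro x hx a b ha hb hab
  obtain ⟨⟨hx1, s, hs, hxs⟩, hxv⟩ := id hx
  have hvs := mem_face_of_mem_openStar hx hxs
  have h := convex_closedFace (X := X) s (vertex_mem_closedFace hvs) ⟨hx1, hxs⟩ ha hb hab
  refine ⟨closedFace_subset hs h, ?_⟩
  have : (a • (X.vertex v : V → ℝ) + b • x) v = a + b * x v := by simp [vertex]
  rw [this]
  rcases ha.eq_or_lt with rfl | ha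
  · have : b = 1 := by simpa using hab
    simpa [this] using hxv
  · have := mul_nonneg hb hxv.le
    linarith

theorem segment_vertex_subset_openStar {v : V} {x : V → ℝ} (hx : x ∈ X.openStar v) :
    segment ℝ x (X.vertex v) ⊆ X.openStar v := by
  rw [segment_symm]
  exact starConvex_iff_segment_subset.1 (starConvex_openStar v) hx

/-- The straight path from a point of the open star of a vertex to that vertex. -/
def toVertex {x : X.realization} {v : V} (hx : (x : V → ℝ) ∈ X.openStar v) : Path x (X.vertex v) :=
  Path.line x (X.vertex v) ((segment_vertex_subset_openStar hx).trans (openStar_subset v))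

theorem toVertex_mem_openStar {x : X.realization} {v : V} (hx : (x : V → ℝ) ∈ X.openStar v)
    (t : unitInterval) : (toVertex hx t : V → ℝ) ∈ X.openStar v :=
  Path.line_mem _ _ _ (segment_vertex_subset_openStar hx) t

theorem toVertex_mem_closedFace {x : X.realization} {v : V} (hx : (x : V → ℝ) ∈ X.openStar v)
    {s : Finset V} (hs : (x : V → ℝ) ∈ X.closedFace s) (t : unitInterval) :
    (toVertex hx t : V → ℝ) ∈ X.closedFace s :=
  Path.line_mem _ _ _ ((convex_closedFace s).segment_subset hs
    (vertex_mem_closedFace (mem_face_of_mem_openStar hx hs.2))) t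

theorem segment_subset_closedFace {s : Finset V} {u v : V} (hu : u ∈ s) (hv : v ∈ s) :
    segment ℝ (X.vertex u : V → ℝ) (X.vertex v) ⊆ X.closedFace s :=
  (convex_closedFace s).segment_subset (vertex_mem_closedFace hu) (vertex_mem_closedFace hv)

/-- The straight path along the edge between two adjacent (or equal) vertices. -/
def edgePath {u v : V} (h : {u, v} ∈ X.faces) : Path (X.vertex u) (X.vertex v) :=
  Path.line _ _ ((segment_subset_closedFace (by simp) (by simp)).trans (closedFace_subset h))

theorem edgePath_mem_closedFace {u v : V} (h : {u, v} ∈ X.faces) {s : Finset V} (hu : u ∈ s)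
    (hv : v ∈ s) (t : unitInterval) : (edgePath h t : V → ℝ) ∈ X.closedFace s :=
  Path.line_mem _ _ _ (segment_subset_closedFace hu hv) t


/-- The homotopy class of the path along an edge. -/
def edge {u v : V} (h : {u, v} ∈ X.faces) : Path.Homotopic.Quotient (X.vertex u) (X.vertex v) :=
  Path.Homotopic.Quotient.mk (edgePath h)

theorem edge_self {u : V} (h : {u, u} ∈ X.faces) : edge h = Path.Homotopic.Quotient.refl (X.vertex u) := by
  rw [edge, edgePath, Path.line_self]; rfl

/-- A closed face is convex, so both paths lie in a contractible set. The three vertices may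
coincide; this is the only homotopy relation among edges that is needed. -/
theorem edge_trans {u v w : V} {s : Finset V} (hs : s ∈ X.faces) (hu : u ∈ s) (hv : v ∈ s)
    (hw : w ∈ s) (huv : {u, v} ∈ X.faces) (hvw : {v, w} ∈ X.faces) (huw : {u, w} ∈ X.faces) :
    (edge huv).trans (edge hvw) = edge huw := by
  rw [edge, edge, edge, ← Path.Homotopic.Quotient.mk_trans, Path.Homotopic.Quotient.eq]
  refine homotopic_of_closedFace hs _ _
    (fun t => ?_) (edgePath_mem_closedFace huw hu hw)
  exact Path.trans_mem (S := {x : X.realization | (x : V → ℝ) ∈ X.closedFace s})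
    (edgePath_mem_closedFace huv hu hv) (edgePath_mem_closedFace hvw hv hw) t

/-- The classes of paths between vertices that are compositions of edges. -/
inductive IsEdgePath : ∀ {u v : V}, Path.Homotopic.Quotient (X.vertex u) (X.vertex v) → Prop
  | refl (u : V) : IsEdgePath (Path.Homotopic.Quotient.refl (X.vertex u))
  | snoc {u v w : V} {γ : Path.Homotopic.Quotient (X.vertex u) (X.vertex v)}
      (hγ : IsEdgePath γ) (h : {v, w} ∈ X.faces) : IsEdgePath (γ.trans (edge h))

/-- A face supporting `x` contains both vertices, and everything happens inside it. This serves to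
change the star that labels a subdivision point of a path. -/
theorem exists_edge_of_mem_openStar {x : X.realization} {u v : V}
    (hu : (x : V → ℝ) ∈ X.openStar u) (hv : (x : V → ℝ) ∈ X.openStar v) :
    ∃ h : {u, v} ∈ X.faces,
      (Path.Homotopic.Quotient.mk (toVertex hu)).symm.trans (Path.Homotopic.Quotient.mk (toVertex hv)) = edge h := by
  obtain ⟨hx, s, hs, hxs⟩ := x.2
  have hus := mem_face_of_mem_openStar hu hxs
  have hvs := mem_face_of_mem_openStar hv hxs
  refine ⟨pair_mem_faces hs hus hvs, ?_⟩
  rw [← Path.Homotopic.Quotient.mk_symm, ← Path.Homotopic.Quotient.mk_trans, edge, Path.Homotopic.Quotient.eq]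
  refine homotopic_of_closedFace hs _ _ (fun t => ?_) (edgePath_mem_closedFace _ hus hvs)
  exact Path.trans_mem (S := {x : X.realization | (x : V → ℝ) ∈ X.closedFace s})
    (p := (toVertex hu).symm) (p' := toVertex hv) (fun t => toVertex_mem_closedFace hu ⟨hx, hxs⟩ _)
    (fun t => toVertex_mem_closedFace hv ⟨hx, hxs⟩ _) t

/-- A path in the open star of `v` is homotopic to the one through `v`. -/
theorem mk_eq_of_openStar {x y : X.realization} {v : V} (p : Path x y)
    (hp : ∀ t, (p t : V → ℝ) ∈ X.openStar v) (hx : (x : V → ℝ) ∈ X.openStar v)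
    (hy : (y : V → ℝ) ∈ X.openStar v) :
    Path.Homotopic.Quotient.mk p = (Path.Homotopic.Quotient.mk (toVertex hx)).trans (Path.Homotopic.Quotient.mk (toVertex hy)).symm := by
  rw [← Path.Homotopic.Quotient.mk_symm, ← Path.Homotopic.Quotient.mk_trans, Path.Homotopic.Quotient.eq]
  refine StarConvex.homotopic (openStar_subset v) (starConvex_openStar v) _ _ hp fun t => ?_
  exact Path.trans_mem (S := {x : X.realization | (x : V → ℝ) ∈ X.openStar v})
    (toVertex_mem_openStar hx) (fun t => toVertex_mem_openStar hy _) t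

/-- The open stars cover the realization, so a fine subdivision puts each piece of the path in a
single star, where the piece can be rerouted through the vertex. -/
theorem isEdgePath_of_path {x y : X.realization} (p : Path x y) {u v : V}
    (hu : (x : V → ℝ) ∈ X.openStar u) (hv : (y : V → ℝ) ∈ X.openStar v) :
    IsEdgePath ((Path.Homotopic.Quotient.mk (toVertex hu)).symm.trans
      ((Path.Homotopic.Quotient.mk p).trans (Path.Homotopic.Quotient.mk (toVertex hv)))) := by
  obtain ⟨t, ht0, htm, ⟨N, hN⟩, ht⟩ := exists_monotone_Icc_subset_open_cover_unitInterval
    (c := fun w : V => p ⁻¹' {x : X.realization | (x : V → ℝ) ∈ X.openStar w})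
    (fun w => (isOpen_openStar w).preimage p.continuous)
    (fun s _ => Set.mem_iUnion.2 (exists_mem_openStar (p s)))
  -- The labels of both ends are arbitrary, so that the induction step may use the star containing
  -- the next piece.
  have key : ∀ n : ℕ, ∀ (w₀ w : V) (h₀ : (p 0 : V → ℝ) ∈ X.openStar w₀)
      (h : (p (t n) : V → ℝ) ∈ X.openStar w),
      IsEdgePath ((Path.Homotopic.Quotient.mk (toVertex h₀)).symm.trans
        ((Path.Homotopic.Quotient.mk (p.subpath 0 (t n))).trans (Path.Homotopic.Quotient.mk (toVertex h)))) := by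
    intro n
    induction n with
    | zero =>
      rw [ht0]
      intro w₀ w h₀ h
      obtain ⟨he, h'⟩ := exists_edge_of_mem_openStar h₀ h
      rw [Path.subpath_self, Path.Homotopic.Quotient.mk_refl, Path.Homotopic.Quotient.refl_trans, h', ← Path.Homotopic.Quotient.refl_trans (edge he)]
      exact .snoc (.refl _) he
    | succ n ih =>
      intro w₀ w h₀ h
      obtain ⟨z, hz⟩ := ht n
      have hle : t n ≤ t (n + 1) := htm n.le_succ
      have h1 : (p (t n) : V → ℝ) ∈ X.openStar z := hz ⟨le_rfl, hle⟩
      have h2 : (p (t (n + 1)) : V → ℝ) ∈ X.openStar z := hz ⟨hle, le_rfl⟩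
      have h3 : Path.Homotopic.Quotient.mk (p.subpath 0 (t (n + 1))) =
          (Path.Homotopic.Quotient.mk (p.subpath 0 (t n))).trans (Path.Homotopic.Quotient.mk (p.subpath (t n) (t (n + 1)))) := by
        rw [← Path.Homotopic.Quotient.mk_trans, Path.Homotopic.Quotient.eq]
        exact ⟨(Path.Homotopy.subpathTransSubpath p _ _ _).symm⟩
      have h4 := mk_eq_of_openStar (p.subpath (t n) (t (n + 1))) (v := z) (fun s => by
        have : p.subpath (t n) (t (n + 1)) s ∈ p '' (Set.Icc (t n) (t (n + 1))) := by
          rw [← Path.range_subpath_of_le _ _ _ hle]; exact ⟨s, rfl⟩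
        obtain ⟨r, hr, hrs⟩ := this
        rw [← hrs]
        exact hz hr) h1 h2
      obtain ⟨he, h5⟩ := exists_edge_of_mem_openStar h2 h
      have := IsEdgePath.snoc (ih w₀ z h₀ h1) he
      rw [← h5] at this
      rw [h3, h4]
      simpa only [Path.Homotopic.Quotient.trans_assoc] using this
  have hlast := key N
  rw [hN N le_rfl, Path.subpath_zero_one] at hlast
  -- The subpath runs from `p 0` to `p 1`, which equal `x` and `y` only propositionally; the cast
  -- transports the result.
  have main : ∀ (x' y' : X.realization) (hx' : x' = x) (hy' : y' = y),
      (∀ (w₀ w : V) (h₀ : (x' : V → ℝ) ∈ X.openStar w₀) (h : (y' : V → ℝ) ∈ X.openStar w),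
        IsEdgePath ((Path.Homotopic.Quotient.mk (toVertex h₀)).symm.trans
          ((Path.Homotopic.Quotient.mk (p.cast hx' hy')).trans (Path.Homotopic.Quotient.mk (toVertex h))))) →
      IsEdgePath ((Path.Homotopic.Quotient.mk (toVertex hu)).symm.trans
        ((Path.Homotopic.Quotient.mk p).trans (Path.Homotopic.Quotient.mk (toVertex hv)))) := by
    rintro _ _ rfl rfl h
    exact h _ _ _ _
  exact main _ _ p.source p.target hlast

theorem toVertex_vertex (v : V) :
    toVertex (vertex_mem_openStar (X := X) v) = Path.refl (X.vertex v) := Path.line_self _ _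

/-- Every path between vertices is homotopic to a composition of edges. -/
theorem isEdgePath {u v : V} (γ : Path.Homotopic.Quotient (X.vertex u) (X.vertex v)) :
    IsEdgePath γ := by
  obtain ⟨p, rfl⟩ := Path.Homotopic.Quotient.mk_surjective γ
  have := isEdgePath_of_path p (vertex_mem_openStar u) (vertex_mem_openStar v)
  rw [toVertex_vertex, toVertex_vertex] at this
  rw [Path.Homotopic.Quotient.mk_refl, Path.Homotopic.Quotient.mk_refl, Path.Homotopic.Quotient.trans_refl] at this
  have h : (Path.Homotopic.Quotient.refl (X.vertex u)).symm = Path.Homotopic.Quotient.refl (X.vertex u) := by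
    rw [← Path.Homotopic.Quotient.mk_refl, ← Path.Homotopic.Quotient.mk_symm, Path.refl_symm]
  rwa [h, Path.Homotopic.Quotient.refl_trans] at this

theorem pathConnectedSpace_realization [Nonempty V] (h : X.TwoNeighborly) :
    PathConnectedSpace X.realization := by
  have hv : ∀ u v, Joined (X.vertex u) (X.vertex v) := fun u v => by
    rcases eq_or_ne u v with rfl | huv
    · exact Joined.refl _
    · exact ⟨edgePath (by convert h u v huv)⟩
  refine ⟨⟨X.vertex (Classical.arbitrary V)⟩, fun x y => ?_⟩
  obtain ⟨u, hu⟩ := exists_mem_openStar x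
  obtain ⟨v, hv'⟩ := exists_mem_openStar y
  exact (Joined.trans ⟨toVertex hu⟩ (hv u v)).trans (Joined.symm ⟨toVertex hv'⟩)

end AbstractSimplicialComplex

/-! ### Winding numbers of paths along maps to the circle -/

section Winding

variable {Z : Type*} [TopologicalSpace Z] (f : C(Z, UnitAddCircle))

/-- The total variation of a real-valued lift of `f` along a path. -/
noncomputable def winding {x y : Z} (γ : Path.Homotopic.Quotient x y) : ℝ :=
  (AddCircle.isCoveringMap_coe (1 : ℝ)).monodromy (γ.map f)
    ⟨_, (QuotientAddGroup.mk_surjective (f x)).choose_spec⟩ -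
      (QuotientAddGroup.mk_surjective (f x)).choose

/-- Lifts with different starting points differ by a constant integer, so the increment, and hence
`winding`, does not depend on the chosen start. -/
theorem monodromy_sub_eq {x y : UnitAddCircle} (γ : Path.Homotopic.Quotient x y)
    (a b : ((↑) : ℝ → UnitAddCircle) ⁻¹' {x}) :
    ((AddCircle.isCoveringMap_coe (1 : ℝ)).monodromy γ a - a : ℝ) =
      (AddCircle.isCoveringMap_coe (1 : ℝ)).monodromy γ b - b := by
  obtain ⟨p, rfl⟩ := Path.Homotopic.Quotient.mk_surjective γ
  obtain ⟨a, ha⟩ := a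
  obtain ⟨b, hb⟩ := b
  have cov := AddCircle.isCoveringMap_coe (1 : ℝ)
  have ha' : p 0 = (a : UnitAddCircle) := p.source.trans ha.symm
  have hb' : p 0 = (b : UnitAddCircle) := p.source.trans hb.symm
  change cov.liftPath p a ha' 1 - a = cov.liftPath p b hb' 1 - b
  have h : cov.liftPath p a ha' + ContinuousMap.const _ (b - a) = cov.liftPath p b hb' := by
    refine (cov.eq_liftPath_iff' _).2 ⟨?_, ?_⟩
    · ext t
      have h1 := congrFun (cov.liftPath_lifts p a ha') t
      have h2 : ((b - a : ℝ) : UnitAddCircle) = 0 := by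
        rw [AddCircle.coe_sub, ← ha', ← hb', sub_self]
      simp only [Function.comp_apply] at h1
      simp only [Function.comp_apply, ContinuousMap.add_apply, ContinuousMap.const_apply,
        AddCircle.coe_add, h1, h2, add_zero]
    · simp [cov.liftPath_zero]
  rw [← h]
  simp only [ContinuousMap.add_apply, ContinuousMap.const_apply]
  ring

theorem winding_trans {x y z : Z} (γ : Path.Homotopic.Quotient x y)
    (γ' : Path.Homotopic.Quotient y z) : winding f (γ.trans γ') = winding f γ + winding f γ' := by
  have h : (γ.trans γ').map f = (γ.map f).trans (γ'.map f) := by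
    obtain ⟨p, rfl⟩ := Path.Homotopic.Quotient.mk_surjective γ
    obtain ⟨p', rfl⟩ := Path.Homotopic.Quotient.mk_surjective γ'
    rw [← Path.Homotopic.Quotient.mk_trans, ← Path.Homotopic.Quotient.mk_map,
      ← Path.Homotopic.Quotient.mk_map, ← Path.Homotopic.Quotient.mk_map, Path.map_trans,
      Path.Homotopic.Quotient.mk_trans]
  rw [winding, winding, winding, h, IsCoveringMap.monodromy_trans_apply]
  rw [monodromy_sub_eq (γ'.map f) ⟨_, (QuotientAddGroup.mk_surjective (f y)).choose_spec⟩
    ((AddCircle.isCoveringMap_coe (1 : ℝ)).monodromy (γ.map f)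
    ⟨_, (QuotientAddGroup.mk_surjective (f x)).choose_spec⟩)]
  ring

/-- Any explicit real lift computes the winding number, by uniqueness of lifts. -/
theorem winding_mk {x y : Z} (p : Path x y) (Γ : C(unitInterval, ℝ))
    (hΓ : ∀ t, (Γ t : UnitAddCircle) = f (p t)) :
    winding f (Path.Homotopic.Quotient.mk p) = Γ 1 - Γ 0 := by
  have cov := AddCircle.isCoveringMap_coe (1 : ℝ)
  have h0 : (Γ 0 : UnitAddCircle) = f x := by rw [hΓ, p.source]
  rw [winding, monodromy_sub_eq _ _ ⟨Γ 0, h0⟩]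
  congr 1
  rw [← Path.Homotopic.Quotient.mk_map]
  have h1 : (p.map f.continuous : C(unitInterval, UnitAddCircle)) 0 = (Γ 0 : UnitAddCircle) :=
    (p.map f.continuous).source.trans h0.symm
  change cov.liftPath (p.map f.continuous) (Γ 0) h1 1 = Γ 1
  rw [← (cov.eq_liftPath_iff' h1).2 ⟨funext hΓ, rfl⟩]

theorem winding_refl (x : Z) : winding f (Path.Homotopic.Quotient.refl x) = 0 := by
  have h := winding_trans f (Path.Homotopic.Quotient.refl x) (Path.Homotopic.Quotient.refl x)
  rw [Path.Homotopic.Quotient.refl_trans] at h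
  linarith

end Winding

/-! ### The complex of a perfect difference set -/

/-- `d` enumerates a perfect difference set of the abelian group `G`: every nonzero element of `G`
is the difference of exactly one pair of members. -/
structure IsPerfectDifference {ι G : Type*} [AddCommGroup G] (d : ι → G) : Prop where
  injective : Function.Injective d
  exists_sub_eq : ∀ a : G, a ≠ 0 → ∃ i j, d i - d j = a
  eq_and_eq : ∀ {i j k l : ι}, i ≠ j → d i - d j = d k - d l → i = k ∧ j = l

section Translates

variable {ι G : Type*} [AddCommGroup G] {d : ι → G}

theorem IsPerfectDifference.neg (hd : IsPerfectDifference d) : IsPerfectDifference (-d) where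
  injective := neg_injective.comp hd.injective
  exists_sub_eq a ha := by
    obtain ⟨i, j, h⟩ := hd.exists_sub_eq a ha
    exact ⟨j, i, by rw [← h]; simp only [Pi.neg_apply]; abel⟩
  eq_and_eq {i j k l} hij h := by
    refine (hd.eq_and_eq hij.symm (k := l) (l := k) ?_).symm
    simp only [Pi.neg_apply] at h
    calc d j - d i = - d i - - d j := by abel
      _ = _ := h
      _ = _ := by abel

variable [Fintype ι] [DecidableEq G]

/-- The translate by `c` of the set of values of `d`. -/
def translateSet (d : ι → G) (c : G) : Finset G := Finset.univ.image fun i => c + d i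

theorem mem_translateSet {c v : G} : v ∈ translateSet d c ↔ ∃ i, c + d i = v := by simp [translateSet]

theorem add_mem_translateSet (c : G) (i : ι) : c + d i ∈ translateSet d c := mem_translateSet.2 ⟨i, rfl⟩

theorem card_translateSet (hd : IsPerfectDifference d) (c : G) :
    (translateSet d c).card = Fintype.card ι := by
  rw [translateSet, Finset.card_image_of_injective _ fun i j h => hd.injective (add_left_cancel h),
    Finset.card_univ]

/-- Distinct translates of a perfect difference set share at most one point. -/
theorem IsPerfectDifference.eq_of_mem_translateSet (hd : IsPerfectDifference d) {c c' u v : G}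
    (huv : u ≠ v) (hu : u ∈ translateSet d c) (hv : v ∈ translateSet d c) (hu' : u ∈ translateSet d c')
    (hv' : v ∈ translateSet d c') : c = c' := by
  obtain ⟨i, rfl⟩ := mem_translateSet.1 hu
  obtain ⟨j, rfl⟩ := mem_translateSet.1 hv
  obtain ⟨k, hk⟩ := mem_translateSet.1 hu'
  obtain ⟨l, hl⟩ := mem_translateSet.1 hv'
  have hij : i ≠ j := by rintro rfl; exact huv rfl
  have : d i - d j = d k - d l := by
    calc d i - d j = (c + d i) - (c + d j) := by abel
      _ = (c' + d k) - (c' + d l) := by rw [hk, hl]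
      _ = _ := by abel
  obtain ⟨rfl, rfl⟩ := hd.eq_and_eq hij this
  exact (add_right_cancel hk).symm

/-- A translate of a perfect difference set `D` and one of `-D` share at most two points. -/
theorem IsPerfectDifference.eq_or_eq (hd : IsPerfectDifference d) {c c' v : G} {i j : ι}
    (hij : c + d i = c' - d j) (hv : v ∈ translateSet d c) (hv' : v ∈ translateSet (-d) c') :
    v = c + d i ∨ v = c + d j := by
  obtain ⟨k, rfl⟩ := mem_translateSet.1 hv
  obtain ⟨l, hl⟩ := mem_translateSet.1 hv'
  rcases eq_or_ne k i with rfl | hki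
  · exact Or.inl rfl
  right
  -- Both `d i + d j` and `d k + d l` equal `c' - c`; the equal sums become equal differences, to
  -- which uniqueness applies.
  have : d k - d i = d j - d l := by
    have h1 : d i + d j = c' - c := by
      calc d i + d j = (c + d i) + d j - c := by abel
        _ = _ := by rw [hij]; abel
    have h2 : d k + d l = c' - c := by
      calc d k + d l = (c + d k) + d l - c := by abel
        _ = _ := by rw [← hl, Pi.neg_apply]; abel
    rw [sub_eq_sub_iff_add_eq_add, h2, add_comm, h1]
  rw [(hd.eq_and_eq hki this).1]

variable [Nonempty ι]

/-- The complex whose facets are the translates of a set and of its negative. -/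
def differenceComplex (d : ι → G) : AbstractSimplicialComplex G where
  faces := {s | s.Nonempty ∧ ∃ c, s ⊆ translateSet d c ∨ s ⊆ translateSet (-d) c}
  isRelLowerSet_faces := by
    rintro s ⟨hs, c, h⟩
    exact ⟨hs, fun t hts ht => ⟨ht, c, h.imp hts.trans hts.trans⟩⟩
  singleton_mem v := by
    let i := Classical.arbitrary ι
    refine ⟨Finset.singleton_nonempty v, v - d i, Or.inl ?_⟩
    rw [Finset.singleton_subset_iff, mem_translateSet]
    exact ⟨i, by abel⟩

theorem translateSet_mem_faces (c : G) : translateSet d c ∈ (differenceComplex d).faces :=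
  ⟨⟨_, add_mem_translateSet c (Classical.arbitrary ι)⟩, c, Or.inl le_rfl⟩

theorem translateSet_neg_mem_faces (c : G) : translateSet (-d) c ∈ (differenceComplex d).faces :=
  ⟨⟨_, add_mem_translateSet c (Classical.arbitrary ι)⟩, c, Or.inr le_rfl⟩

end Translates

/-! ### Circle-valued coordinates and their winding along edges -/

section CircleMap

theorem coe_eq_zero_of_support_subset_singleton {V : Type*} [Fintype V] {x : V → ℝ}
    (hx : x ∈ stdSimplex ℝ V) {v : V} (h : ∀ u, x u ≠ 0 → u = v) (w : V) :
    (x w : UnitAddCircle) = 0 := by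
  by_cases hw : x w = 0
  · simp [hw]
  · have hwv := h w hw
    subst hwv
    have : x w = 1 := by
      rw [← hx.2, Finset.sum_eq_single w]
      · intro b _ hb
        by_contra hb'
        exact hb (h b hb')
      · simp
    rw [this]
    exact AddCircle.coe_period 1

theorem coe_add_eq_zero_of_support_subset_pair {V : Type*} [Fintype V] {x : V → ℝ}
    (hx : x ∈ stdSimplex ℝ V) {v w : V} (h : ∀ u, x u ≠ 0 → u = v ∨ u = w) :
    (x v : UnitAddCircle) + (x w : UnitAddCircle) = 0 := by
  classical
  rcases eq_or_ne v w with rfl | hvw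
  · rw [coe_eq_zero_of_support_subset_singleton hx (v := v) (by simpa using h), add_zero]
  · have : x v + x w = 1 := by
      rw [← hx.2, ← Finset.sum_pair hvw]
      refine Finset.sum_subset (Finset.subset_univ _) fun u _ hu => ?_
      by_contra hu'
      exact hu (by simpa using h u hu')
    rw [← AddCircle.coe_add, this]
    exact AddCircle.coe_period 1

variable {ι G : Type*} [AddCommGroup G] [DecidableEq G] [Fintype G] [Fintype ι] {d : ι → G}

/-- Two distinct translates of the difference set share at most one point, so `x` is then a vertex
and all its coordinates are integers. -/
theorem IsPerfectDifference.coe_add_eq (hd : IsPerfectDifference d) {x : G → ℝ}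
    (hx : x ∈ stdSimplex ℝ G) {c c' : G} (h : Function.support x ⊆ (translateSet d c : Set G))
    (h' : Function.support x ⊆ (translateSet d c' : Set G)) (i : ι) :
    (x (c + d i) : UnitAddCircle) = x (c' + d i) := by
  rcases eq_or_ne c c' with rfl | hc
  · rfl
  by_cases h0 : x = 0
  · simp [h0]
  obtain ⟨v, hv⟩ := Function.ne_iff.1 h0
  have : ∀ u, x u ≠ 0 → u = v := fun u hu => by
    by_contra huv
    exact hc (hd.eq_of_mem_translateSet huv (h hu) (h hv) (h' hu) (h' hv))
  rw [coe_eq_zero_of_support_subset_singleton hx this,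
    coe_eq_zero_of_support_subset_singleton hx this]

/-- The common vertices of the two facets form at most a pair, and the two coordinates in question
belong to that pair. They sum to 1 when the vertices differ, and are integers otherwise. -/
theorem IsPerfectDifference.coe_add_coe_eq_zero (hd : IsPerfectDifference d) {x : G → ℝ}
    (hx : x ∈ stdSimplex ℝ G) {c c' : G} (h : Function.support x ⊆ (translateSet d c : Set G))
    (h' : Function.support x ⊆ (translateSet (-d) c' : Set G)) (i : ι) :
    (x (c + d i) : UnitAddCircle) + x (c' - d i) = 0 := by
  -- The roles of `d` and `-d` are symmetric, so it suffices to treat a nonzero first coordinate;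
  -- the case of a nonzero second one is this claim for `-d`.
  have aux : ∀ {d : ι → G} (_ : IsPerfectDifference d) {c c' : G}
      (_ : Function.support x ⊆ (translateSet d c : Set G))
      (_ : Function.support x ⊆ (translateSet (-d) c' : Set G)), x (c + d i) ≠ 0 →
      (x (c + d i) : UnitAddCircle) + x (c' - d i) = 0 := by
    intro d hd c c' h h' h0
    obtain ⟨j, hj⟩ := mem_translateSet.1 (h' h0)
    rw [Pi.neg_apply, ← sub_eq_add_neg] at hj
    have hj' : c' - d i = c + d j := by
      rw [sub_eq_iff_eq_add, add_right_comm, ← hj]; abel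
    rw [hj']
    exact coe_add_eq_zero_of_support_subset_pair hx fun u hu =>
      hd.eq_or_eq hj.symm (h hu) (h' hu)
  by_cases h0 : x (c + d i) = 0
  · by_cases h1 : x (c' - d i) = 0
    · simp [h0, h1]
    · have := aux hd.neg h' (by rwa [neg_neg]) (by rwa [Pi.neg_apply, ← sub_eq_add_neg])
      rwa [Pi.neg_apply, ← sub_eq_add_neg, sub_neg_eq_add, add_comm] at this
  · exact aux hd h h' h0

variable [Nonempty ι]

open Classical in
/-- The `i`-th barycentric coordinate modulo `1` on the translates of the difference set, and its
opposite on the translates of the negative. -/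
noncomputable def circleFun (d : ι → G) (i : ι) (x : (differenceComplex d).realization) :
    UnitAddCircle :=
  if h : ∃ c, Function.support (x : G → ℝ) ⊆ (translateSet d c : Set G)
  then ((x : G → ℝ) (h.choose + d i) : UnitAddCircle)
  else if h : ∃ c, Function.support (x : G → ℝ) ⊆ (translateSet (-d) c : Set G)
  then -((x : G → ℝ) (h.choose - d i) : UnitAddCircle) else 0

theorem circleFun_eq (hd : IsPerfectDifference d) (i : ι) {x : (differenceComplex d).realization}
    {c : G} (h : Function.support (x : G → ℝ) ⊆ (translateSet d c : Set G)) :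
    circleFun d i x = ((x : G → ℝ) (c + d i) : UnitAddCircle) := by
  have hex : ∃ c, Function.support (x : G → ℝ) ⊆ (translateSet d c : Set G) := ⟨c, h⟩
  rw [circleFun, dif_pos hex]
  exact hd.coe_add_eq x.2.1 hex.choose_spec h i

theorem circleFun_eq_neg (hd : IsPerfectDifference d) (i : ι)
    {x : (differenceComplex d).realization} {c : G}
    (h : Function.support (x : G → ℝ) ⊆ (translateSet (-d) c : Set G)) :
    circleFun d i x = -((x : G → ℝ) (c - d i) : UnitAddCircle) := by
  by_cases hex : ∃ c, Function.support (x : G → ℝ) ⊆ (translateSet d c : Set G)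
  · rw [circleFun, dif_pos hex]
    exact eq_neg_of_add_eq_zero_left (hd.coe_add_coe_eq_zero x.2.1 hex.choose_spec h i)
  · have hex' : ∃ c, Function.support (x : G → ℝ) ⊆ (translateSet (-d) c : Set G) := ⟨c, h⟩
    rw [circleFun, dif_neg hex, dif_pos hex']
    simpa [sub_eq_add_neg] using hd.neg.coe_add_eq x.2.1 hex'.choose_spec h i

theorem isClosed_support_subset {V : Type*} (T : Set (V → ℝ)) (s : Set V) :
    IsClosed {x : T | Function.support (x : V → ℝ) ⊆ s} := by
  have : {x : T | Function.support (x : V → ℝ) ⊆ s} = ⋂ v ∈ sᶜ, {x : T | (x : V → ℝ) v = 0} := by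
    ext x
    simp only [Set.mem_ofPred_eq, Set.mem_iInter, Set.mem_compl_iff]
    exact ⟨fun h v hv => by by_contra h0; exact hv (h h0), fun h v hv => by
      by_contra h0; exact hv (h v h0)⟩
  rw [this]
  exact isClosed_biInter fun v _ =>
    isClosed_eq ((continuous_apply v).comp continuous_subtype_val) continuous_const

/-- The closed facets form a finite closed cover, and on each of them the function is plus or minus
a coordinate modulo 1. -/
theorem continuous_circleFun (hd : IsPerfectDifference d) (i : ι) :
    Continuous (circleFun d i) := by
  have hc : ∀ v : G, Continuous fun x : (differenceComplex d).realization =>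
      ((x : G → ℝ) v : UnitAddCircle) := fun v =>
    (AddCircle.isCoveringMap_coe 1).continuous.comp ((continuous_apply v).comp continuous_subtype_val)
  let F : G ⊕ G → Set (differenceComplex d).realization := Sum.elim
    (fun c => {x | Function.support (x : G → ℝ) ⊆ (translateSet d c : Set G)})
    (fun c => {x | Function.support (x : G → ℝ) ⊆ (translateSet (-d) c : Set G)})
  refine LocallyFinite.continuous (f := F) (locallyFinite_of_finite F) ?_ ?_ ?_
  · refine Set.eq_univ_of_forall fun x => ?_
    obtain ⟨s, ⟨-, c, h | h⟩, hs⟩ := x.2.2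
    · exact Set.mem_iUnion.2 ⟨Sum.inl c, hs.trans (by exact_mod_cast h)⟩
    · exact Set.mem_iUnion.2 ⟨Sum.inr c, hs.trans (by exact_mod_cast h)⟩
  · rintro (c | c) <;> exact isClosed_support_subset _ _
  · rintro (c | c)
    · exact (hc (c + d i)).continuousOn.congr fun x hx => circleFun_eq hd i hx
    · exact (hc (c - d i)).neg.continuousOn.congr fun x hx => circleFun_eq_neg hd i hx

/-- The map to the circle given by `circleFun`. -/
noncomputable def coordCircle (hd : IsPerfectDifference d) (i : ι) :
    C((differenceComplex d).realization, UnitAddCircle) :=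
  ⟨circleFun d i, continuous_circleFun hd i⟩

open AbstractSimplicialComplex

/-- The edge lies in one translate of the difference set, where the coordinate itself is a real
lift. -/
theorem winding_edge [DecidableEq ι] (hd : IsPerfectDifference d) (i : ι) {c : G} {j k : ι}
    {u v : G} (hu : c + d j = u) (hv : c + d k = v)
    (h : {u, v} ∈ (differenceComplex d).faces) :
    winding (coordCircle hd i) (edge h) = (if i = k then 1 else 0) - (if i = j then 1 else 0) := by
  subst hu hv
  let Γ : C(unitInterval, ℝ) := ⟨fun t => (edgePath h t : G → ℝ) (c + d i),
    (continuous_apply _).comp (continuous_subtype_val.comp (edgePath h).continuous)⟩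
  have hΓ : ∀ t, (Γ t : UnitAddCircle) = coordCircle hd i (edgePath h t) := fun t =>
    (circleFun_eq hd i (edgePath_mem_closedFace h (add_mem_translateSet c j)
      (add_mem_translateSet c k) t).2).symm
  have key : ∀ l, ((differenceComplex d).vertex (c + d l) : G → ℝ) (c + d i) =
      if i = l then 1 else 0 := fun l => by
    simp [vertex, Pi.single_apply, hd.injective.eq_iff]
  rw [edge, winding_mk _ _ Γ hΓ]
  change (edgePath h 1 : G → ℝ) (c + d i) - (edgePath h 0 : G → ℝ) (c + d i) = _
  rw [Path.target, Path.source, key, key]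

end CircleMap

/-! ### The fundamental group of the complex of a perfect difference set -/

/-- The kernel of a homomorphism from `ℤ ^ q` to a finite group is isomorphic to `ℤ ^ q`. -/
theorem nonempty_ker_addEquiv {q : ℕ} {G : Type*} [AddCommGroup G]
    [Fintype G] (f : (Fin q → ℤ) →+ G) : Nonempty (f.ker ≃+ (Fin q → ℤ)) := by
  let N : Submodule ℤ (Fin q → ℤ) := f.ker.toIntSubmodule
  -- Multiplication by the order of `G` embeds ℤ^q in the kernel, which therefore has full rank.
  let g : (Fin q → ℤ) →ₗ[ℤ] N :=
    { toFun := fun a => ⟨Fintype.card G • a, by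
        change f (Fintype.card G • a) = 0
        rw [map_nsmul, card_nsmul_eq_zero]⟩
      map_add' := fun a b => Subtype.ext (smul_add _ a b)
      map_smul' := fun m a => Subtype.ext (smul_comm _ m a) }
  have hg : Function.Injective g := by
    intro a b h
    have h' : Fintype.card G • a = Fintype.card G • b := congrArg Subtype.val h
    exact smul_right_injective _ (Fintype.card_ne_zero (α := G)) h'
  have h1 := LinearMap.finrank_le_finrank_of_injective hg
  have h2 := Submodule.finrank_le N
  have h3 : Module.finrank ℤ (Fin q → ℤ) = q := by simp
  have h4 : Module.finrank ℤ N = q := by omega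
  exact ⟨(Module.finBasisOfFinrankEq ℤ N h4).equivFun.toAddEquiv⟩

noncomputable section

namespace DifferenceComplex

open AbstractSimplicialComplex

variable {q : ℕ} {G : Type*} [AddCommGroup G] {d : Fin (q + 1) → G}

/-- The homomorphism whose kernel is the lattice of the closed paths. -/
def latticeMap (d : Fin (q + 1) → G) : (Fin q → ℤ) →+ G where
  toFun a := ∑ i, a i • (d i.succ - d 0)
  map_zero' := by simp
  map_add' a b := by simp [add_zsmul, Finset.sum_add_distrib]

/-- The inclusion of the lattice of the closed paths in the space of real vectors. -/
def latticeInclusion (d : Fin (q + 1) → G) :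
    Multiplicative (latticeMap d).ker →* Multiplicative (Fin q → ℝ) :=
  AddMonoidHom.toMultiplicative
    { toFun := fun a k => ((a : Fin q → ℤ) k : ℝ)
      map_zero' := by ext; simp
      map_add' := fun a b => by ext; simp }

theorem latticeInclusion_injective : Function.Injective (latticeInclusion d) := by
  intro a b h
  apply Multiplicative.toAdd.injective
  ext k
  have : (((a.toAdd : Fin q → ℤ) k : ℤ) : ℝ) = ((b.toAdd : Fin q → ℤ) k : ℤ) :=
    congrFun (Multiplicative.ofAdd.injective h) k
  exact_mod_cast this

variable [DecidableEq G]

theorem pair_mem_faces_step (d : Fin (q + 1) → G) (i j : Fin (q + 1)) (v : G) :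
    {v, v - d j + d i} ∈ (differenceComplex d).faces :=
  pair_mem_faces (translateSet_mem_faces (d := d) (v - d j))
    (mem_translateSet.2 ⟨j, sub_add_cancel _ _⟩) (add_mem_translateSet _ _)

variable [Fintype G]

/-- The homotopy classes of paths from the vertex `0` to an arbitrary vertex. -/
abbrev PathClass (d : Fin (q + 1) → G) : Type _ :=
  Σ v : G, Path.Homotopic.Quotient ((differenceComplex d).vertex 0) ((differenceComplex d).vertex v)

/-- Extension of a path by an edge. -/
def PathClass.extend (s : PathClass d) (v : G) (h : {s.1, v} ∈ (differenceComplex d).faces) :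
    PathClass d := ⟨v, s.2.trans (edge h)⟩

theorem PathClass.extend_congr (s : PathClass d) {v w : G}
    (h : {s.1, v} ∈ (differenceComplex d).faces) (hvw : v = w) :
    s.extend v h = s.extend w (hvw ▸ h) := by subst hvw; rfl

theorem PathClass.extend_self (s : PathClass d) (h : {s.1, s.1} ∈ (differenceComplex d).faces) :
    s.extend s.1 h = s := by
  rw [extend, edge_self, Path.Homotopic.Quotient.trans_refl]

theorem PathClass.extend_extend (s : PathClass d) {v w : G} {t : Finset G}
    (ht : t ∈ (differenceComplex d).faces) (hs : s.1 ∈ t) (hv : v ∈ t) (hw : w ∈ t)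
    (h : {s.1, v} ∈ (differenceComplex d).faces) (h' : {v, w} ∈ (differenceComplex d).faces) :
    (s.extend v h).extend w h' = s.extend w (pair_mem_faces ht hs hw) := by
  simp only [extend]
  rw [Path.Homotopic.Quotient.trans_assoc, edge_trans ht hs hv hw]

/-- Extension of a path by the edge whose difference is `d i - d j`. -/
def step (i j : Fin (q + 1)) (s : PathClass d) : PathClass d :=
  s.extend (s.1 - d j + d i) (pair_mem_faces_step d i j s.1)

theorem step_fst (i j : Fin (q + 1)) (s : PathClass d) : (step i j s).1 = s.1 - d j + d i := rfl

theorem step_self (i : Fin (q + 1)) (s : PathClass d) : step i i s = s := by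
  rw [step, s.extend_congr _ (sub_add_cancel s.1 (d i)), s.extend_self]

/-- The three vertices form a triangle in the translate of D by `s.1 - d k`. -/
theorem step_step (i j k : Fin (q + 1)) (s : PathClass d) :
    step i j (step j k s) = step i k s := by
  refine (PathClass.extend_extend s (translateSet_mem_faces (d := d) (s.1 - d k))
    (mem_translateSet.2 ⟨k, sub_add_cancel _ _⟩) (add_mem_translateSet _ _)
    (mem_translateSet.2 ⟨i, by simp [step_fst]⟩) _ _).trans ?_
  exact s.extend_congr _ (by simp [step_fst])

/-- The three vertices form a triangle in the translate of -D by `s.1 + d k`. The composition rule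
comes out in the opposite order, which is what yields commutativity. -/
theorem step_step' (i j k : Fin (q + 1)) (s : PathClass d) :
    step i j (step k i s) = step k j s := by
  refine (PathClass.extend_extend s (translateSet_neg_mem_faces (d := d) (s.1 + d k))
    (mem_translateSet.2 ⟨k, by simp⟩)
    (mem_translateSet.2 ⟨i, by simp only [Pi.neg_apply]; abel⟩)
    (mem_translateSet.2 ⟨j, by simp only [Pi.neg_apply, step_fst]; abel⟩) _ _).trans ?_
  exact s.extend_congr _ (by simp only [step_fst]; abel)

/-- The permutation of the path classes given by the edges of difference `d i - d j`. -/
def stepPerm (d : Fin (q + 1) → G) (i j : Fin (q + 1)) : Equiv.Perm (PathClass d) where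
  toFun := step i j
  invFun := step j i
  left_inv s := by rw [step_step, step_self]
  right_inv s := by rw [step_step, step_self]

theorem stepPerm_inv (i j : Fin (q + 1)) : (stepPerm d i j)⁻¹ = stepPerm d j i := rfl

theorem stepPerm_self (i : Fin (q + 1)) : stepPerm d i i = 1 := Equiv.ext (step_self i)

theorem stepPerm_mul (i j k : Fin (q + 1)) :
    stepPerm d i j * stepPerm d j k = stepPerm d i k := Equiv.ext (step_step i j k)

theorem stepPerm_mul' (i j k : Fin (q + 1)) :
    stepPerm d i j * stepPerm d k i = stepPerm d k j := Equiv.ext (step_step' i j k)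

/-- The product of the steps (i, 0) and (0, j) is the step (i, j) in either order: once by a
triangle in a translate of D, once by one in a translate of -D. -/
theorem commute_stepPerm (i j : Fin (q + 1)) : Commute (stepPerm d i 0) (stepPerm d j 0) := by
  have h : Commute (stepPerm d i 0) (stepPerm d j 0)⁻¹ := by
    rw [stepPerm_inv, Commute, SemiconjBy, stepPerm_mul, stepPerm_mul']
  simpa using h.inv_right

/-- The action of `ℤ ^ q` on the path classes, in which the generators act by the edges of
difference `d i - d 0`. -/
def latticeAction (d : Fin (q + 1) → G) :
    (Fin q → Multiplicative ℤ) →* Equiv.Perm (PathClass d) :=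
  MonoidHom.noncommPiCoprod (fun i => zpowersHom _ (stepPerm d i.succ 0)) fun i j _ x y => by
    simpa using ((commute_stepPerm i.succ j.succ).zpow_zpow _ _)

/-- The vector by which the edge of difference `d i - d 0` acts: a unit vector, or `0`. -/
def unitVector (i : Fin (q + 1)) : Fin q → Multiplicative ℤ :=
  fun j => Multiplicative.ofAdd (if j.succ = i then 1 else 0)

theorem latticeAction_unitVector (i : Fin (q + 1)) :
    latticeAction d (unitVector i) = stepPerm d i 0 := by
  refine Fin.cases ?_ (fun k => ?_) i
  · have : unitVector (0 : Fin (q + 1)) = 1 := by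
      ext j; simp [unitVector, Fin.succ_ne_zero]
    rw [this, map_one, stepPerm_self]
  · have : unitVector k.succ = Pi.mulSingle k (Multiplicative.ofAdd 1) := by
      ext j
      by_cases h : j = k
      · subst h; simp [unitVector]
      · simp [unitVector, h]
    rw [this]
    exact (MonoidHom.noncommPiCoprod_mulSingle _ k _).trans (by simp)

theorem stepPerm_eq (i j : Fin (q + 1)) :
    stepPerm d i j = latticeAction d (unitVector i / unitVector j) := by
  rw [map_div, latticeAction_unitVector, latticeAction_unitVector, div_eq_mul_inv, stepPerm_inv,
    stepPerm_mul]

/-- The class of the constant path. -/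
def basePath (d : Fin (q + 1) → G) : PathClass d := ⟨0, Path.Homotopic.Quotient.refl _⟩

/-- The winding numbers of a path class along all circle maps but the one of index `0`. -/
def windings (hd : IsPerfectDifference d) (s : PathClass d) (i : Fin q) : ℝ :=
  winding (coordCircle hd i.succ) s.2

theorem windings_basePath (hd : IsPerfectDifference d) : windings hd (basePath d) = 0 := by
  ext i
  exact winding_refl _ _

theorem windings_step (hd : IsPerfectDifference d) (i j : Fin (q + 1)) (s : PathClass d)
    (k : Fin q) : windings hd (step i j s) k = windings hd s k +
      (((unitVector i / unitVector j) k).toAdd : ℝ) := by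
  rw [windings, step, PathClass.extend, winding_trans,
    winding_edge hd _ (sub_add_cancel s.1 (d j)) rfl]
  simp [windings, unitVector]

/-- Every nonzero element is a difference of members of D; a degenerate edge is the trivial step (0,
0). -/
theorem exists_step_eq (hd : IsPerfectDifference d) (s : PathClass d) {v : G}
    (h : {s.1, v} ∈ (differenceComplex d).faces) : ∃ i j, s.extend v h = step i j s := by
  by_cases hv : v = s.1
  · exact ⟨0, 0, by rw [step_self, s.extend_congr h hv, s.extend_self]⟩
  · obtain ⟨i, j, hij⟩ := hd.exists_sub_eq _ (sub_ne_zero.2 hv)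
    exact ⟨i, j, s.extend_congr h (by rw [sub_add_eq_add_sub, add_sub_assoc, hij]; abel)⟩

/-- Every path class is reached from the constant path by a lattice vector, which is the vector of
its winding numbers. -/
theorem exists_latticeAction_eq (hd : IsPerfectDifference d) (s : PathClass d) :
    ∃ a : Fin q → Multiplicative ℤ, latticeAction d a (basePath d) = s ∧
      ∀ k, windings hd s k = ((a k).toAdd : ℝ) := by
  obtain ⟨v, γ⟩ := s
  -- The starting vertex is a variable here because induction on `IsEdgePath` needs free indices.
  have key : ∀ {u v : G}
      (γ : Path.Homotopic.Quotient ((differenceComplex d).vertex u) ((differenceComplex d).vertex v)),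
      IsEdgePath γ → ∀ hu : u = 0, ∃ a : Fin q → Multiplicative ℤ,
        latticeAction d a (basePath d) = ⟨v, hu ▸ γ⟩ ∧
        ∀ k, windings hd ⟨v, hu ▸ γ⟩ k = ((a k).toAdd : ℝ) := by
    intro u v γ hγ
    induction hγ with
    | refl =>
      rintro rfl
      exact ⟨1, by simp [basePath], fun k => by
        simpa using! congrFun (windings_basePath hd) k⟩
    | @snoc v w γ _ h ih =>
      rintro rfl
      obtain ⟨a, ha, ha'⟩ := ih rfl
      obtain ⟨i, j, hij⟩ := exists_step_eq hd (⟨v, γ⟩ : PathClass d) h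
      have hij' : (⟨w, γ.trans (edge h)⟩ : PathClass d) = step i j ⟨v, γ⟩ := hij
      refine ⟨(unitVector i / unitVector j) * a, ?_, fun k => ?_⟩
      · rw [map_mul, Equiv.Perm.mul_apply, ha, ← stepPerm_eq]
        exact hij'.symm
      · change windings hd ⟨w, γ.trans (edge h)⟩ k = _
        rw [hij', windings_step, ha']
        simp [add_comm]
  exact key γ (isEdgePath γ) rfl

/-- The windings determine the lattice vector, and the vector determines the path class it reaches
from the constant path. -/
theorem windings_injective (hd : IsPerfectDifference d) : Function.Injective (windings hd) := by
  intro s t h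
  obtain ⟨a, ha, ha'⟩ := exists_latticeAction_eq hd s
  obtain ⟨b, hb, hb'⟩ := exists_latticeAction_eq hd t
  have : a = b := by
    funext k
    have := ha' k
    rw [h, hb' k] at this
    exact (Multiplicative.toAdd.injective (by exact_mod_cast this)).symm
  rw [← ha, ← hb, this]

theorem latticeAction_apply (hd : IsPerfectDifference d) (a : Fin q → ℤ) (s : PathClass d) :
    (latticeAction d (fun k => Multiplicative.ofAdd (a k)) s).1 = s.1 + latticeMap d a ∧
      ∀ k, windings hd (latticeAction d (fun k => Multiplicative.ofAdd (a k)) s) k =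
        windings hd s k + a k := by
  -- Both identities are additive in `a`, so the vectors satisfying them for all `s` form a
  -- subgroup, and unit vectors suffice.
  let P : AddSubgroup (Fin q → ℤ) :=
    { carrier := {a | ∀ s : PathClass d,
        (latticeAction d (fun k => Multiplicative.ofAdd (a k)) s).1 = s.1 + latticeMap d a ∧
        ∀ k, windings hd (latticeAction d (fun k => Multiplicative.ofAdd (a k)) s) k =
          windings hd s k + a k}
      zero_mem' := fun s => by
        have : (fun k => Multiplicative.ofAdd ((0 : Fin q → ℤ) k)) = 1 := rfl
        rw [this, map_one]
        simp
      add_mem' := fun {a b} ha hb s => by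
        have : (fun k => Multiplicative.ofAdd ((a + b) k)) =
          (fun k => Multiplicative.ofAdd (a k)) * (fun k => Multiplicative.ofAdd (b k)) := rfl
        rw [this, map_mul, Equiv.Perm.mul_apply, (ha _).1, (hb _).1, map_add]
        refine ⟨by abel, fun k => ?_⟩
        rw [(ha _).2, (hb _).2]
        push_cast [Pi.add_apply]
        ring
      neg_mem' := fun {a} ha s => by
        have : (fun k => Multiplicative.ofAdd ((-a) k)) =
          (fun k => Multiplicative.ofAdd (a k))⁻¹ := rfl
        rw [this, map_inv]
        obtain ⟨t, rfl⟩ := (latticeAction d (fun k => Multiplicative.ofAdd (a k))).surjective s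
        rw [← Equiv.Perm.mul_apply, inv_mul_cancel, Equiv.Perm.one_apply, (ha _).1, map_neg]
        refine ⟨by abel, fun k => ?_⟩
        rw [(ha _).2]
        push_cast [Pi.neg_apply]
        ring }
  have hP : ∀ i, Pi.single i 1 ∈ P := fun i s => by
    have h1 : (fun k => Multiplicative.ofAdd ((Pi.single i 1 : Fin q → ℤ) k)) =
        unitVector i.succ := by
      ext k
      simp [unitVector, Pi.single_apply]
    have h2 : latticeMap d (Pi.single i 1) = d i.succ - d 0 := by
      change ∑ j, (Pi.single i 1 : Fin q → ℤ) j • (d j.succ - d 0) = _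
      rw [Finset.sum_eq_single i] <;> simp +contextual
    rw [h1, latticeAction_unitVector, h2]
    refine ⟨?_, fun k => ?_⟩
    · change s.1 - d 0 + d i.succ = _
      abel
    · change windings hd (step i.succ 0 s) k = _
      rw [windings_step]
      simp [unitVector, Pi.single_apply, Fin.succ_ne_zero]
  have ha : a ∈ P := by
    have : a = ∑ i, a i • (Pi.single i 1 : Fin q → ℤ) := by
      ext k
      simp [Finset.sum_apply, Pi.single_apply]
    rw [this]
    exact sum_mem fun i _ => zsmul_mem (hP i) _
  exact ha s

/-- The winding numbers, as a homomorphism. -/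
def windingHom (hd : IsPerfectDifference d) :
    FundamentalGroup (differenceComplex d).realization ((differenceComplex d).vertex 0) →*
      Multiplicative (Fin q → ℝ) where
  toFun γ := Multiplicative.ofAdd (windings hd ⟨0, γ⟩)
  map_one' := by
    have := windings_basePath hd
    exact this
  map_mul' γ γ' := by
    rw [← ofAdd_add]
    congr 1
    ext k
    -- The product in the fundamental group unfolds to concatenation in the reverse order; this is
    -- harmless in a commutative target.
    have := winding_trans (coordCircle hd k.succ) γ' γ
    exact this.trans (add_comm (winding (coordCircle hd k.succ) γ') _)

theorem windingHom_injective (hd : IsPerfectDifference d) :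
    Function.Injective (windingHom hd) := by
  intro γ γ' h
  have := windings_injective hd (a₁ := ⟨0, γ⟩) (a₂ := ⟨0, γ'⟩) h
  simpa using this

/-- A vector moves the base vertex 0 to its image under `latticeMap`, so it comes from a loop
exactly when it lies in the kernel. -/
theorem range_windingHom (hd : IsPerfectDifference d) :
    (windingHom hd).range = (latticeInclusion d).range := by
  ext w
  constructor
  · rintro ⟨γ, rfl⟩
    obtain ⟨a, ha, ha'⟩ := exists_latticeAction_eq hd ⟨0, γ⟩
    have h0 := (latticeAction_apply hd (fun k => (a k).toAdd) (basePath d)).1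
    change (latticeAction d a (basePath d)).1 = _ at h0
    rw [ha] at h0
    refine ⟨Multiplicative.ofAdd ⟨fun k => (a k).toAdd, ?_⟩, ?_⟩
    · rw [AddMonoidHom.mem_ker]
      have h1 : (basePath d).1 = 0 := rfl
      rw [h1, zero_add] at h0
      exact h0.symm
    · apply Multiplicative.toAdd.injective
      ext k
      exact (ha' k).symm
  · rintro ⟨a, rfl⟩
    obtain ⟨a, ha⟩ := a
    obtain ⟨h1, h2⟩ := latticeAction_apply hd a (basePath d)
    rw [AddMonoidHom.mem_ker.1 ha] at h1
    rw [windings_basePath] at h2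
    generalize latticeAction d (fun k => Multiplicative.ofAdd (a k)) (basePath d) = s at h1 h2
    obtain ⟨v, γ⟩ := s
    have hv : v = 0 := by simpa [basePath] using h1
    subst hv
    refine ⟨γ, ?_⟩
    apply Multiplicative.toAdd.injective
    ext k
    have := h2 k
    rw [Pi.zero_apply, zero_add] at this
    exact this

/-- The fundamental group of the complex is the lattice of the closed paths. -/
theorem nonempty_fundamentalGroup_mulEquiv_ker (hd : IsPerfectDifference d) :
    Nonempty (FundamentalGroup (differenceComplex d).realization ((differenceComplex d).vertex 0) ≃*
      Multiplicative (latticeMap d).ker) :=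
  ⟨(MonoidHom.ofInjective (windingHom_injective hd)).trans
    ((MulEquiv.subgroupCongr (range_windingHom hd)).trans
      (MonoidHom.ofInjective latticeInclusion_injective).symm)⟩

theorem nonempty_fundamentalGroup_mulEquiv (hd : IsPerfectDifference d)
    (h : PathConnectedSpace (differenceComplex d).realization)
    (x : (differenceComplex d).realization) :
    Nonempty (FundamentalGroup (differenceComplex d).realization x ≃*
      Multiplicative (Fin q → ℤ)) := by
  obtain ⟨e⟩ := nonempty_fundamentalGroup_mulEquiv_ker hd
  obtain ⟨e'⟩ := nonempty_ker_addEquiv (latticeMap d)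
  exact ⟨((FundamentalGroup.fundamentalGroupMulEquivOfPathConnected x _).trans e).trans
    (AddEquiv.toMultiplicative e')⟩

end DifferenceComplex

end

/-! ### Singer difference sets -/

section Singer

open Module

theorem Submodule.eq_span_singleton_of_finrank_eq_one {K M : Type*} [Field K] [AddCommGroup M]
    [Module K M] {U : Submodule K M} (hU : finrank K U = 1) {u : M} (hu : u ∈ U) (hu0 : u ≠ 0) :
    U = K ∙ u := by
  have : FiniteDimensional K U := FiniteDimensional.of_finrank_pos (by omega)
  refine (Submodule.eq_of_le_of_finrank_le ((Submodule.span_singleton_le_iff_mem _ _).2 hu) ?_).symm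
  rw [hU, finrank_span_singleton hu0]

theorem Submodule.eq_of_mem_of_finrank_eq_two {K M : Type*} [Field K] [AddCommGroup M]
    [Module K M] {U W : Submodule K M} (hU : finrank K U = 2) (hW : finrank K W = 2) {u v : M}
    (hu0 : u ≠ 0) (huv : v ∉ K ∙ u) (huU : u ∈ U) (hvU : v ∈ U) (huW : u ∈ W) (hvW : v ∈ W) :
    U = W := by
  have h : ∀ {U : Submodule K M}, finrank K U = 2 → u ∈ U → v ∈ U → (K ∙ u) ⊔ (K ∙ v) = U := by
    intro U hU hu hv
    have : FiniteDimensional K U := FiniteDimensional.of_finrank_pos (by omega)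
    have hle : (K ∙ u) ⊔ (K ∙ v) ≤ U := sup_le ((Submodule.span_singleton_le_iff_mem _ _).2 hu)
      ((Submodule.span_singleton_le_iff_mem _ _).2 hv)
    refine Submodule.eq_of_le_of_finrank_le hle ?_
    have : FiniteDimensional K ((K ∙ u) ⊔ (K ∙ v) : Submodule K M) :=
      Submodule.finiteDimensional_of_le hle
    have hlt : (K ∙ u) < (K ∙ u) ⊔ (K ∙ v) :=
      left_lt_sup.2 fun h => huv (h (Submodule.mem_span_singleton_self v))
    have := Submodule.finrank_lt_finrank_of_lt hlt
    rw [finrank_span_singleton hu0] at this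
    omega
  rw [← h hU huU hvU, h hW huW hvW]

variable {K L : Type*} [Field K] [Field L] [Algebra K L]

/-- A plane in a cubic extension that is stable under multiplication by `y` forces `y` to be in
the base field. -/
theorem mem_range_algebraMap_of_mul_mem (h3 : finrank K L = 3) {U : Submodule K L}
    (hU : finrank K U = 2) {y : L} (hy : ∀ u ∈ U, y * u ∈ U) : y ∈ (algebraMap K L).range := by
  have : FiniteDimensional K L := FiniteDimensional.of_finrank_pos (by omega)
  have hint : IsIntegral K y := .of_finite K y
  obtain ⟨u, hu, hu0⟩ : ∃ u ∈ U, u ≠ 0 := U.exists_mem_ne_zero_of_ne_bot (by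
    rintro rfl; simp at hU)
  have hpow : ∀ k : ℕ, y ^ k * u ∈ U := fun k => by
    induction k with
    | zero => simpa
    | succ k ih => rw [pow_succ', mul_assoc]; exact hy _ ih
  -- The powers of `y` below its degree, times `u`, are independent in the plane `U`. So the degree
  -- is at most 2; it also divides 3, hence equals 1.
  have hli : LinearIndependent K fun i : Fin (minpoly K y).natDegree =>
      (⟨y ^ (i : ℕ) * u, hpow i⟩ : U) := by
    refine LinearIndependent.of_comp U.subtype ?_
    exact (linearIndependent_pow y).map' (LinearMap.mulRight K u)
      (LinearMap.ker_eq_bot.2 (mul_left_injective₀ hu0))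
  have h1 := hli.fintype_card_le_finrank
  rw [hU, Fintype.card_fin] at h1
  have h2 := minpoly.degree_dvd hint (K := K)
  rw [h3] at h2
  have h4 := minpoly.natDegree_pos hint
  rw [← minpoly.natDegree_eq_one_iff (A := K)]
  interval_cases h : (minpoly K y).natDegree
  · rfl
  · omega

variable {A : Type*} [AddCommGroup A] {T : Lˣ →* Multiplicative A}

/-- The image of a subspace under multiplication by a unit. -/
def mulSubspace (x : Lˣ) (U : Submodule K L) : Submodule K L :=
  U.map (LinearMap.mulLeft K (x : L))

theorem finrank_mulSubspace (x : Lˣ) (U : Submodule K L) :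
    finrank K (mulSubspace x U) = finrank K U :=
  (Submodule.equivMapOfInjective _ (mul_right_injective₀ x.ne_zero) U).finrank_eq.symm

theorem mem_mulSubspace {x : Lˣ} {U : Submodule K L} {y : L} :
    y ∈ mulSubspace x U ↔ (x⁻¹ : Lˣ) * y ∈ U := by
  rw [mulSubspace, Submodule.mem_map]
  constructor
  · rintro ⟨u, hu, rfl⟩
    simpa using hu
  · intro h
    exact ⟨_, h, by simp⟩

/-- The values of `T` on the nonzero elements of a subspace. -/
def valueSet (T : Lˣ →* Multiplicative A) (U : Submodule K L) : Set A :=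
  {a | ∃ x : Lˣ, (x : L) ∈ U ∧ (T x).toAdd = a}

theorem mem_range_iff {x : L} (hx : x ≠ 0) : x ∈ (algebraMap K L).range ↔
    Units.mk0 x hx ∈ (Units.map (algebraMap K L).toMonoidHom).range := by
  constructor
  · rintro ⟨k, rfl⟩
    have hk : k ≠ 0 := by rintro rfl; simp at hx
    exact ⟨Units.mk0 k hk, Units.ext rfl⟩
  · rintro ⟨k, hk⟩
    exact ⟨k, congrArg Units.val hk⟩

section

variable (hT : T.ker = (Units.map (algebraMap K L).toMonoidHom).range)

include hT

theorem apply_eq_iff {x y : Lˣ} : T x = T y ↔ (y : L) ∈ (K ∙ (x : L)) := by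
  rw [Submodule.mem_span_singleton, eq_comm, ← div_eq_one, ← map_div, ← MonoidHom.mem_ker, hT]
  constructor
  · rintro ⟨k, hk⟩
    refine ⟨k, ?_⟩
    have : y = Units.map (algebraMap K L).toMonoidHom k * x := by rw [hk]; simp
    rw [this, Algebra.smul_def]
    rfl
  · rintro ⟨k, hk⟩
    have hk0 : k ≠ 0 := by
      rintro rfl
      exact y.ne_zero (by rw [← hk, zero_smul])
    refine ⟨Units.mk0 k hk0, ?_⟩
    rw [eq_div_iff_mul_eq']
    ext
    rw [← hk, Algebra.smul_def]
    rfl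

theorem mem_valueSet_iff {U : Submodule K L} {x : Lˣ} :
    (T x).toAdd ∈ valueSet T U ↔ (x : L) ∈ U := by
  constructor
  · rintro ⟨y, hy, hxy⟩
    exact (Submodule.span_singleton_le_iff_mem _ _).2 hy
      ((apply_eq_iff hT).1 (Multiplicative.toAdd.injective hxy))
  · exact fun h => ⟨x, h, rfl⟩

/-- Two distinct planes in 3-space meet in a line. If the planes coincided, `U` would be stable
under `y⁻¹`, putting `y` in the base field. -/
theorem finrank_inf_mulSubspace (h3 : finrank K L = 3) {U : Submodule K L}
    (hU : finrank K U = 2) {y : Lˣ} (hy : T y ≠ 1) :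
    finrank K (U ⊓ mulSubspace y U : Submodule K L) = 1 := by
  have : FiniteDimensional K L := FiniteDimensional.of_finrank_pos (by omega)
  have h1 := Submodule.finrank_sup_add_finrank_inf_eq U (mulSubspace y U)
  have h2 := Submodule.finrank_le (U ⊔ mulSubspace y U)
  rw [finrank_mulSubspace, hU] at h1
  have h4 := Submodule.finrank_mono (inf_le_left : U ⊓ mulSubspace y U ≤ U)
  by_contra h
  have h5 : U ⊓ mulSubspace y U = U := Submodule.eq_of_le_of_finrank_le inf_le_left (by omega)
  have h6 : U ≤ mulSubspace y U := inf_eq_left.1 h5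
  have h7 := mem_range_algebraMap_of_mul_mem h3 hU (y := (y⁻¹ : Lˣ)) fun u hu =>
    mem_mulSubspace.1 (h6 hu)
  rw [mem_range_iff (y⁻¹).ne_zero, Units.mk0_val, ← hT, MonoidHom.mem_ker, map_inv,
    inv_eq_one] at h7
  exact hy h7

/-- Singer's theorem: the values on a plane form a perfect difference set. -/
theorem isPerfectDifference_valueSet (hs : Function.Surjective T) (h3 : finrank K L = 3)
    {U : Submodule K L} (hU : finrank K U = 2) :
    IsPerfectDifference (Subtype.val : valueSet T U → A) where
  injective := Subtype.val_injective
  exists_sub_eq a ha := by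
    obtain ⟨y, hy⟩ := hs (Multiplicative.ofAdd a)
    have h1 := finrank_inf_mulSubspace hT h3 hU (y := y) (by
      rw [hy]; exact fun h => ha (Multiplicative.ofAdd.injective h))
    obtain ⟨z, hz, hz0⟩ := (U ⊓ mulSubspace y U).exists_mem_ne_zero_of_ne_bot (by
      intro h; rw [h] at h1; simp at h1)
    have hz2 := mem_mulSubspace.1 hz.2
    -- For `z` in `U ∩ yU`, both `z` and `y⁻¹z` lie in `U`, and their values differ by `T y`, that
    -- is, by `a`.
    refine ⟨⟨_, Units.mk0 z hz0, hz.1, rfl⟩, ⟨_, y⁻¹ * Units.mk0 z hz0, hz2, rfl⟩, ?_⟩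
    simp only [map_mul, map_inv, hy, toAdd_mul, toAdd_inv, toAdd_ofAdd]
    abel
  eq_and_eq {i j k l} hij h := by
    obtain ⟨_, xi, hi, rfl⟩ := i
    obtain ⟨_, xj, hj, rfl⟩ := j
    obtain ⟨_, xk, hk, rfl⟩ := k
    obtain ⟨_, xl, hl, rfl⟩ := l
    have hne : T (xi / xj) ≠ 1 := fun h1 => hij (by
      rw [map_div, div_eq_one] at h1
      exact Subtype.ext (congrArg Multiplicative.toAdd h1))
    have h1 := finrank_inf_mulSubspace hT h3 hU hne
    -- Both `xi` and `xk` lie in the intersection of `U` with its multiple by `xi / xj`, which is a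
    -- line; hence they have the same value.
    have hi' : (xi : L) ∈ U ⊓ mulSubspace (xi / xj) U := ⟨hi, mem_mulSubspace.2 (by
      rw [← Units.val_mul]; simpa using hj)⟩
    have hk' : (xk : L) ∈ U ⊓ mulSubspace (xi / xj) U := ⟨hk, mem_mulSubspace.2 (by
      rw [← Units.val_mul, ← mem_valueSet_iff hT]
      refine ⟨xl, hl, ?_⟩
      simp only [map_mul, map_inv, map_div, toAdd_mul, toAdd_inv, toAdd_div]
      simp only at h
      rw [h]; abel)⟩
    rw [Submodule.eq_span_singleton_of_finrank_eq_one h1 hi' xi.ne_zero] at hk'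
    have hik := (apply_eq_iff hT).2 hk'
    have hik' : (T xi).toAdd = (T xk).toAdd := congrArg _ hik
    refine ⟨Subtype.ext hik', Subtype.ext ?_⟩
    simp only at h ⊢
    rw [hik'] at h
    exact sub_right_injective h

end

end Singer

/-- Ordered pairs of distinct indices correspond bijectively to nonzero elements. This determines
the size of a Singer set. -/
theorem IsPerfectDifference.card_mul_card_sub_one {ι G : Type*} [Fintype ι] [Fintype G]
    [AddCommGroup G] {d : ι → G} (hd : IsPerfectDifference d) :
    Fintype.card ι * (Fintype.card ι - 1) = Fintype.card G - 1 := by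
  classical
  have h1 : (Finset.univ : Finset ι).offDiag.card = (Finset.univ.erase (0 : G)).card := by
    refine Finset.card_bij (fun p _ => d p.1 - d p.2) ?_ ?_ ?_
    · rintro ⟨i, j⟩ h
      simpa [sub_eq_zero, hd.injective.eq_iff] using h
    · rintro ⟨i, j⟩ h ⟨k, l⟩ - hkl
      obtain ⟨rfl, rfl⟩ := hd.eq_and_eq (by simpa using h) hkl
      rfl
    · intro a ha
      obtain ⟨i, j, hij⟩ := hd.exists_sub_eq a (by simpa using ha)
      refine ⟨(i, j), ?_, hij⟩
      simp only [Finset.mem_offDiag, Finset.mem_univ, true_and]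
      rintro rfl
      simp [← hij] at ha
  rw [Finset.offDiag_card, Finset.card_erase_of_mem (Finset.mem_univ _), Finset.card_univ,
    Finset.card_univ] at h1
  rw [Nat.mul_sub_one, h1]

theorem IsPerfectDifference.comp_equiv {ι κ G : Type*} [AddCommGroup G] {d : ι → G}
    (hd : IsPerfectDifference d) (e : κ ≃ ι) : IsPerfectDifference (d ∘ e) where
  injective := hd.injective.comp e.injective
  exists_sub_eq a ha := by
    obtain ⟨i, j, h⟩ := hd.exists_sub_eq a ha
    exact ⟨e.symm i, e.symm j, by simpa using h⟩
  eq_and_eq hij h := by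
    obtain ⟨h1, h2⟩ := hd.eq_and_eq (e.injective.ne hij) h
    exact ⟨e.injective h1, e.injective h2⟩

/-! ### The labelling of the plane by a cyclic group -/

section Singer

open Module

/-- The multiplicative group of a cubic extension of a finite field, modulo the one of the base
field, is cyclic of order `q ^ 2 + q + 1`. -/
theorem exists_hom_ker_eq_range (K L : Type*) [Field K] [Field L] [Algebra K L] [Finite K]
    [Finite L] (h3 : finrank K L = 3) :
    ∃ T : Lˣ →* Multiplicative (ZMod (Nat.card K ^ 2 + Nat.card K + 1)),
      Function.Surjective T ∧ T.ker = (Units.map (algebraMap K L).toMonoidHom).range := by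
  set H := (Units.map (algebraMap K L).toMonoidHom).range with hH
  have hcard : Nat.card (Lˣ ⧸ H) = Nat.card K ^ 2 + Nat.card K + 1 := by
    have h1 := Subgroup.card_eq_card_quotient_mul_card_subgroup H
    have hinj : Function.Injective (Units.map (algebraMap K L).toMonoidHom) :=
      Units.map_injective (algebraMap K L).injective
    have h2 : Nat.card H = Nat.card K - 1 := by
      rw [← Nat.card_units, ← Nat.card_congr (MonoidHom.ofInjective hinj).toEquiv]
    have : Module.Finite K L := .of_finite
    rw [h2, Nat.card_units, Module.natCard_eq_pow_finrank (K := K), h3] at h1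
    have h4 : 1 < Nat.card K := Finite.one_lt_card
    obtain ⟨r, hr⟩ := Nat.exists_eq_add_of_lt h4
    rw [hr] at h1 ⊢
    -- This is q³ - 1 = (q² + q + 1)(q - 1), with q written as 1 + r + 1.
    have h5 : (1 + r + 1) ^ 3 - 1 = ((1 + r + 1) ^ 2 + (1 + r + 1) + 1) * (1 + r + 1 - 1) := by
      rw [Nat.add_sub_cancel, Nat.sub_eq_iff_eq_add (Nat.one_le_pow _ _ (by omega))]
      ring
    rw [h5] at h1
    exact (Nat.eq_of_mul_eq_mul_right (by omega) h1).symm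
  rw [← hcard]
  let e := zmodCyclicMulEquiv (inferInstance : IsCyclic (Lˣ ⧸ H))
  refine ⟨e.symm.toMonoidHom.comp (QuotientGroup.mk' H),
    e.symm.surjective.comp (QuotientGroup.mk'_surjective H), ?_⟩
  ext x
  simp

theorem exists_submodule_finrank_eq_two {K L : Type*} [Field K] [AddCommGroup L] [Module K L]
    (h3 : finrank K L = 3) : ∃ U : Submodule K L, finrank K U = 2 := by
  have : FiniteDimensional K L := FiniteDimensional.of_finrank_pos (by omega)
  let b := finBasisOfFinrankEq K L h3
  have := b.linearIndependent.comp (Fin.castSucc : Fin 2 → Fin 3) (Fin.castSucc_injective 2)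
  exact ⟨_, (finrank_span_eq_card this).trans (Fintype.card_fin 2)⟩

section

variable {K L : Type*} [Field K] [Field L] [Algebra K L] {A : Type*} [AddCommGroup A]
  {T : Lˣ →* Multiplicative A}
  (hT : T.ker = (Units.map (algebraMap K L).toMonoidHom).range) {U : Submodule K L}
  {ι : Type*} [Fintype ι] {d : ι → A} (hdU : Set.range d = valueSet T U)

include hT

theorem span_singleton_eq_iff {x y : Lˣ} : K ∙ (x : L) = K ∙ (y : L) ↔ T x = T y := by
  rw [apply_eq_iff hT]
  constructor
  · exact fun h => h ▸ Submodule.mem_span_singleton_self _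
  · exact fun h => Submodule.eq_span_singleton_of_finrank_eq_one
      (finrank_span_singleton x.ne_zero) h y.ne_zero

variable [DecidableEq A]

include hdU

theorem mem_mulSubspace_iff {x y : Lˣ} {c : A} (hx : T x = Multiplicative.ofAdd c) :
    (y : L) ∈ mulSubspace x U ↔ (T y).toAdd ∈ translateSet d c := by
  rw [mem_mulSubspace, ← Units.val_mul, ← mem_valueSet_iff hT, mem_translateSet, ← hdU]
  have : (T (x⁻¹ * y)).toAdd = (T y).toAdd - c := by
    rw [map_mul, map_inv, hx, toAdd_mul, toAdd_inv, toAdd_ofAdd]; abel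
  rw [this]
  exact exists_congr fun i => eq_sub_iff_add_eq'

/-- Take independent `u`, `v` in `W`. The difference of their values is some `d i - d j`, so the
translate by `T u - d i` contains both values, and two independent vectors determine a plane. -/
theorem exists_mulSubspace_eq (hU : finrank K U = 2) (hd : IsPerfectDifference d)
    {W : Submodule K L} (hW : finrank K W = 2) :
    ∃ c : A, ∀ x : Lˣ, T x = Multiplicative.ofAdd c → mulSubspace x U = W := by
  obtain ⟨u, hu, hu0⟩ := W.exists_mem_ne_zero_of_ne_bot (by
    rintro rfl; simp at hW)
  obtain ⟨v, hv, huv⟩ : ∃ v ∈ W, v ∉ K ∙ u := by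
    by_contra! h
    have : FiniteDimensional K (K ∙ u) := inferInstance
    have h1 := Submodule.finrank_mono (show W ≤ K ∙ u from h)
    rw [hW, finrank_span_singleton hu0] at h1
    omega
  have hv0 : v ≠ 0 := by rintro rfl; exact huv (zero_mem _)
  lift u to Lˣ using hu0.isUnit
  lift v to Lˣ using hv0.isUnit
  have hne : (T u).toAdd ≠ (T v).toAdd := fun h =>
    huv ((apply_eq_iff hT).1 (Multiplicative.toAdd.injective h))
  obtain ⟨i, j, hij⟩ := hd.exists_sub_eq _ (sub_ne_zero.2 hne)
  refine ⟨(T u).toAdd - d i, fun x hx => ?_⟩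
  refine Submodule.eq_of_mem_of_finrank_eq_two ((finrank_mulSubspace _ _).trans hU) hW hu0 huv
    ((mem_mulSubspace_iff hT hdU hx).2 (mem_translateSet.2 ⟨i, sub_add_cancel _ _⟩))
    ((mem_mulSubspace_iff hT hdU hx).2 (mem_translateSet.2 ⟨j, ?_⟩)) hu hv
  rw [sub_add, hij, sub_sub_cancel]

/-- The points and lines of the plane of a cubic extension are labelled by a group, in such a way
that the lines become the translates of a perfect difference set. -/
theorem exists_equiv_PG (h3 : finrank K L = 3) (hs : Function.Surjective T)
    (hU : finrank K U = 2) (hι : 1 < Fintype.card ι) (hd : IsPerfectDifference d) :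
    ∃ (e : PGPoint K ≃ A) (f : PGLine K ≃ A), ∀ p l, p.1 ≤ l.1 ↔ e p ∈ translateSet d (f l) := by
  have : FiniteDimensional K L := FiniteDimensional.of_finrank_pos (by omega)
  obtain ⟨φ⟩ : Nonempty (L ≃ₗ[K] (Fin 3 → K)) := ⟨LinearEquiv.ofFinrankEq _ _ (by simp [h3])⟩
  obtain ⟨s, hs⟩ : ∃ s : A → Lˣ, ∀ c, T (s c) = Multiplicative.ofAdd c :=
    ⟨fun c => (hs (Multiplicative.ofAdd c)).choose,
      fun c => (hs (Multiplicative.ofAdd c)).choose_spec⟩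
  let P : A → PGPoint K := fun c => ⟨(K ∙ (s c : L)).map φ.toLinearMap,
    (LinearEquiv.finrank_map_eq φ _).trans (finrank_span_singleton (s c).ne_zero)⟩
  let ℓ : A → PGLine K := fun c => ⟨(mulSubspace (s c) U).map φ.toLinearMap,
    (LinearEquiv.finrank_map_eq φ _).trans ((finrank_mulSubspace _ _).trans hU)⟩
  have hφ : ∀ W : Submodule K (Fin 3 → K),
      (W.map φ.symm.toLinearMap).map φ.toLinearMap = W := fun W => by
    rw [← Submodule.map_comp]
    simp
  have hinc : ∀ c b, (P c).1 ≤ (ℓ b).1 ↔ c ∈ translateSet d b := by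
    intro c b
    change (K ∙ (s c : L)).map φ.toLinearMap ≤ (mulSubspace (s b) U).map φ.toLinearMap ↔ _
    rw [Submodule.map_le_map_iff_of_injective φ.injective, Submodule.span_singleton_le_iff_mem,
      mem_mulSubspace_iff hT hdU (hs b), hs, toAdd_ofAdd]
  have hP : Function.Bijective P := by
    constructor
    · intro b c h
      have h1 := (span_singleton_eq_iff hT).1
        (Submodule.map_injective_of_injective φ.injective (congrArg Subtype.val h))
      rw [hs, hs] at h1
      exact Multiplicative.ofAdd.injective h1
    · rintro ⟨W, hW⟩
      have hW' : finrank K (W.map φ.symm.toLinearMap) = 1 :=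
        (LinearEquiv.finrank_map_eq φ.symm _).trans hW
      obtain ⟨v, hv, hv0⟩ := (W.map φ.symm.toLinearMap).exists_mem_ne_zero_of_ne_bot (by
        intro h; rw [h] at hW'; simp at hW')
      lift v to Lˣ using hv0.isUnit
      refine ⟨(T v).toAdd, Subtype.ext ?_⟩
      have h1 : K ∙ (s (T v).toAdd : L) = K ∙ (v : L) :=
        (span_singleton_eq_iff hT).2 (by rw [hs, ofAdd_toAdd])
      change (K ∙ (s (T v).toAdd : L)).map φ.toLinearMap = W
      rw [h1, ← Submodule.eq_span_singleton_of_finrank_eq_one hW' hv hv0, hφ]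
  have hℓ : Function.Bijective ℓ := by
    constructor
    · intro b c h
      -- A line is recovered from its set of points, which has more than one member.
      have h1 : translateSet d b = translateSet d c := by
        ext a; rw [← hinc, ← hinc, h]
      obtain ⟨u, hu, v, hv, huv⟩ := Finset.one_lt_card.1
        (by rwa [card_translateSet hd] : 1 < (translateSet d b).card)
      exact hd.eq_of_mem_translateSet huv hu hv (h1 ▸ hu) (h1 ▸ hv)
    · rintro ⟨W, hW⟩
      obtain ⟨c, hc⟩ := exists_mulSubspace_eq hT hdU hU hd
        ((LinearEquiv.finrank_map_eq φ.symm _).trans hW)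
      refine ⟨c, Subtype.ext ?_⟩
      change (mulSubspace (s c) U).map φ.toLinearMap = W
      rw [hc _ (hs c), hφ]
  refine ⟨(Equiv.ofBijective P hP).symm, (Equiv.ofBijective ℓ hℓ).symm, fun p l => ?_⟩
  rw [← hinc]
  have h1 : P ((Equiv.ofBijective P hP).symm p) = p := (Equiv.ofBijective P hP).apply_symm_apply p
  have h2 : ℓ ((Equiv.ofBijective ℓ hℓ).symm l) = l := (Equiv.ofBijective ℓ hℓ).apply_symm_apply l
  rw [h1, h2]

end

/-- The points and lines of `PG(2, K)` can be labelled by the integers modulo `q ^ 2 + q + 1` in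
such a way that the lines become the translates of a perfect difference set. -/
theorem exists_perfectDifference_PG (K : Type*) [Field K] [Finite K] {q : ℕ}
    (hq : Nat.card K = q) :
    ∃ d : Fin (q + 1) → ZMod (q ^ 2 + q + 1), IsPerfectDifference d ∧
      ∃ (e : PGPoint K ≃ ZMod (q ^ 2 + q + 1)) (f : PGLine K ≃ ZMod (q ^ 2 + q + 1)),
        ∀ p l, p.1 ≤ l.1 ↔ e p ∈ translateSet d (f l) := by
  classical
  subst hq
  set q := Nat.card K
  have hq1 : 1 < q := Finite.one_lt_card
  obtain ⟨p, hp⟩ := CharP.exists K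
  have : Fact p.Prime := ⟨(CharP.char_is_prime_or_zero K p).resolve_right
    (CharP.char_ne_zero_of_finite K p)⟩
  let L := FiniteField.Extension K p 3
  have h3 : finrank K L = 3 := FiniteField.finrank_extension K p 3
  obtain ⟨T, hs, hT⟩ := exists_hom_ker_eq_range K L h3
  obtain ⟨U, hU⟩ := exists_submodule_finrank_eq_two h3
  have hd := isPerfectDifference_valueSet hT hs h3 hU
  have hcard : Fintype.card (valueSet T U) = q + 1 := by
    have h := hd.card_mul_card_sub_one
    rw [ZMod.card] at h
    generalize Fintype.card (valueSet T U) = c at h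
    -- The equation c(c - 1) = q² + q has the only natural solution c = q + 1.
    obtain _ | c := c
    · simp only [zero_mul, Nat.add_sub_cancel] at h
      nlinarith
    · simp only [Nat.add_sub_cancel] at h
      have : c = q := by
        rcases lt_trichotomy c q with h' | h' | h'
        · nlinarith
        · exact h'
        · nlinarith
      rw [this]
  let ε : Fin (q + 1) ≃ valueSet T U := (Fintype.equivFinOfCardEq hcard).symm
  have hd' := hd.comp_equiv ε
  exact ⟨_, hd', exists_equiv_PG hT (by rw [EquivLike.range_comp, Subtype.range_val]) h3 hs hU
    (by rw [Fintype.card_fin]; omega) hd'⟩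

end Singer

/-! ### Combinatorics of the complex of a perfect difference set -/

section Combinatorics

open AbstractSimplicialComplex

variable {ι G : Type*} [AddCommGroup G] [DecidableEq G] [Fintype ι] {d : ι → G}

theorem translateSet_injective (hd : IsPerfectDifference d) (hι : 1 < Fintype.card ι) :
    Function.Injective (translateSet d) := by
  intro b c h
  obtain ⟨u, hu, v, hv, huv⟩ :=
    Finset.one_lt_card.1 (by rwa [card_translateSet hd] : 1 < (translateSet d b).card)
  exact hd.eq_of_mem_translateSet huv hu hv (h ▸ hu) (h ▸ hv)

theorem card_of_mem_range (hd : IsPerfectDifference d) {t : Finset G}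
    (ht : t ∈ Set.range (translateSet d) ∪ Set.range (translateSet (-d))) :
    t.card = Fintype.card ι := by
  obtain ⟨c, rfl⟩ | ⟨c, rfl⟩ := ht
  exacts [card_translateSet hd c, card_translateSet hd.neg c]

/-- A three-term progression would represent `a` as a difference in two ways. This excludes fixed
points inside a face. -/
theorem IsPerfectDifference.eq_zero_of_mem_translateSet (hd : IsPerfectDifference d) {a c v : G}
    (h0 : v ∈ translateSet d c) (h1 : a + v ∈ translateSet d c)
    (h2 : a + (a + v) ∈ translateSet d c) : a = 0 := by
  obtain ⟨i, hi⟩ := mem_translateSet.1 h0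
  obtain ⟨j, hj⟩ := mem_translateSet.1 h1
  obtain ⟨k, hk⟩ := mem_translateSet.1 h2
  have e1 : d j - d i = a := by rw [← add_sub_add_left_eq_sub _ _ c, hi, hj]; abel
  have e2 : d k - d j = a := by rw [← add_sub_add_left_eq_sub _ _ c, hj, hk]; abel
  by_cases hij : j = i
  · rw [← e1, hij, sub_self]
  · rw [← e1, (hd.eq_and_eq hij (e1.trans e2.symm)).2, sub_self]

theorem neg_mem_translateSet_neg {c v : G} :
    -v ∈ translateSet (-d) (-c) ↔ v ∈ translateSet d c := by
  simp only [mem_translateSet, Pi.neg_apply]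
  refine exists_congr fun i => ?_
  rw [← neg_add, neg_inj]

theorem isCopyOfPG_range_translateSet {K : Type*} [Field K] (hd : IsPerfectDifference d)
    (hι : 1 < Fintype.card ι) (X : AbstractSimplicialComplex G) (e : PGPoint K ≃ G)
    (f : PGLine K ≃ G) (h : ∀ p l, p.1 ≤ l.1 ↔ e p ∈ translateSet d (f l)) :
    X.IsCopyOfPG K (Set.range (translateSet d)) :=
  ⟨e, f.trans (Equiv.ofInjective _ (translateSet_injective hd hι)), h⟩

theorem ncard_range_translateSet [Fintype G] (hd : IsPerfectDifference d)
    (hι : 1 < Fintype.card ι) : (Set.range (translateSet d)).ncard = Fintype.card G := by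
  rw [← Set.image_univ, Set.ncard_image_of_injective _ (translateSet_injective hd hι),
    Set.ncard_univ, Nat.card_eq_fintype_card]

variable [Nonempty ι]

theorem exists_subset_of_mem_faces {s : Finset G} (hs : s ∈ (differenceComplex d).faces) :
    ∃ t ∈ Set.range (translateSet d) ∪ Set.range (translateSet (-d)), s ⊆ t := by
  obtain ⟨-, c, h | h⟩ := hs
  exacts [⟨_, Or.inl ⟨c, rfl⟩, h⟩, ⟨_, Or.inr ⟨c, rfl⟩, h⟩]

theorem mem_faces_of_mem_range {t : Finset G}
    (ht : t ∈ Set.range (translateSet d) ∪ Set.range (translateSet (-d))) :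
    t ∈ (differenceComplex d).faces := by
  obtain ⟨c, rfl⟩ | ⟨c, rfl⟩ := ht
  exacts [translateSet_mem_faces c, translateSet_neg_mem_faces c]

/-- All translates of D and -D have the same size, so none is properly contained in another. -/
theorem facets_differenceComplex (hd : IsPerfectDifference d) : (differenceComplex d).facets =
    Set.range (translateSet d) ∪ Set.range (translateSet (-d)) := by
  ext s
  constructor
  · rintro ⟨hs, hmax⟩
    obtain ⟨t, ht, hst⟩ := exists_subset_of_mem_faces hs
    rwa [hst.antisymm (hmax (mem_faces_of_mem_range ht) hst)]
  · intro hs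
    refine ⟨mem_faces_of_mem_range hs, fun t ht hst => ?_⟩
    obtain ⟨r, hr, htr⟩ := exists_subset_of_mem_faces ht
    have : s = r := Finset.eq_of_subset_of_card_le (hst.trans htr)
      (by rw [card_of_mem_range hd hs, card_of_mem_range hd hr])
    exact this ▸ htr

/-- Translates of D and of -D share at most two points, but have at least three. -/
theorem disjoint_range_translateSet (hd : IsPerfectDifference d) (hι : 2 < Fintype.card ι) :
    Disjoint (Set.range (translateSet d)) (Set.range (translateSet (-d))) := by
  rw [Set.disjoint_left]
  rintro _ ⟨c, rfl⟩ ⟨c', hc⟩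
  let i := Classical.arbitrary ι
  obtain ⟨j, hj⟩ := mem_translateSet.1 (hc ▸ add_mem_translateSet (d := d) c i)
  rw [Pi.neg_apply, ← sub_eq_add_neg] at hj
  have h1 : translateSet d c ⊆ {c + d i, c + d j} := fun v hv => by
    simpa using hd.eq_or_eq hj.symm hv (hc ▸ hv)
  have h2 := (Finset.card_le_card h1).trans Finset.card_le_two
  rw [card_translateSet hd] at h2
  omega

theorem hasDimension_differenceComplex (hd : IsPerfectDifference d) {q : ℕ}
    (hι : Fintype.card ι = q + 1) : (differenceComplex d).HasDimension q := by
  refine ⟨fun s hs => ?_, translateSet d 0, translateSet_mem_faces 0,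
    (card_translateSet hd 0).trans hι⟩
  obtain ⟨t, ht, hst⟩ := exists_subset_of_mem_faces hs
  exact (Finset.card_le_card hst).trans ((card_of_mem_range hd ht).trans hι).le

theorem twoNeighborly_differenceComplex (hd : IsPerfectDifference d) :
    (differenceComplex d).TwoNeighborly := by
  intro u v huv
  obtain ⟨i, j, hij⟩ := hd.exists_sub_eq (u - v) (sub_ne_zero.2 huv)
  convert pair_mem_faces (translateSet_mem_faces (d := d) (u - d i))
    (mem_translateSet.2 ⟨i, sub_add_cancel _ _⟩)
    (mem_translateSet.2 ⟨j, (by rw [sub_add, hij]; abel : u - d i + d j = v)⟩)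

/-- The action of the group by translations. -/
def translationHom (d : ι → G) : Multiplicative G →* (differenceComplex d).aut where
  toFun g := ⟨Equiv.addLeft g.toAdd, by
    have key : ∀ (a : G) (s : Finset G), s ∈ (differenceComplex d).faces →
        s.map (Equiv.addLeft a).toEmbedding ∈ (differenceComplex d).faces := by
      rintro a s ⟨hs, c, h⟩
      refine ⟨hs.map, a + c, ?_⟩
      have h' : ∀ d : ι → G, s ⊆ translateSet d c →
          s.map (Equiv.addLeft a).toEmbedding ⊆ translateSet d (a + c) := by
        intro d h v hv
        obtain ⟨u, hu, rfl⟩ := Finset.mem_map.1 hv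
        obtain ⟨i, rfl⟩ := mem_translateSet.1 (h hu)
        exact mem_translateSet.2 ⟨i, add_assoc _ _ _⟩
      exact h.imp (h' d) (h' (-d))
    intro s
    refine ⟨fun h => ?_, key _ s⟩
    convert key (-g.toAdd) _ h
    ext v
    simp [Finset.mem_map_equiv]⟩
  map_one' := by ext; simp
  map_mul' g h := by ext; simp

theorem translationHom_apply (g : Multiplicative G) (v : G) :
    (translationHom d g : Equiv.Perm G) v = g.toAdd + v := rfl

theorem actsFreely_translationHom [Fintype G] (hd : IsPerfectDifference d) :
    (differenceComplex d).ActsFreely (translationHom d) := by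
  refine ⟨fun g hg v h => hg ?_, fun g hg x h => hg ?_⟩
  · rw [translationHom_apply] at h
    exact Multiplicative.toAdd.injective (by simpa using h)
  -- The coordinates of a fixed point are invariant under translation by `g`, so a face supporting
  -- it contains a progression of difference `g`.
  · have hx : ∀ v, (x : G → ℝ) (g.toAdd + v) = (x : G → ℝ) v := fun v => by
      conv_lhs => rw [← h]
      change (x : G → ℝ) ((translationHom d g : Equiv.Perm G)⁻¹
        ((translationHom d g : Equiv.Perm G) v)) = _
      simp
    obtain ⟨v, hv⟩ := exists_mem_openStar x
    have hv0 : (x : G → ℝ) v ≠ 0 := hv.2.ne'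
    have hv1 : (x : G → ℝ) (g.toAdd + v) ≠ 0 := by rwa [hx]
    have hv2 : (x : G → ℝ) (g.toAdd + (g.toAdd + v)) ≠ 0 := by rwa [hx]
    obtain ⟨s, ⟨-, c, hs | hs⟩, hsupp⟩ := x.2.2
    · exact Multiplicative.toAdd.injective (hd.eq_zero_of_mem_translateSet (hs (hsupp hv0))
        (hs (hsupp hv1)) (hs (hsupp hv2)))
    · exact Multiplicative.toAdd.injective (hd.neg.eq_zero_of_mem_translateSet (hs (hsupp hv0))
        (hs (hsupp hv1)) (hs (hsupp hv2)))

end Combinatorics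

theorem mainTheorem2 (q p m : ℕ) [Fact p.Prime] (hm : 0 < m) (hq : q = p ^ m) :
    ∃ (V : Type) (_ : Fintype V) (X : AbstractSimplicialComplex V),
      ConnectedSpace X.realization ∧
      X.HasDimension q ∧
      (∀ x : X.realization,
        Nonempty (FundamentalGroup X.realization x ≃* Multiplicative (Fin q → ℤ))) ∧
      Fintype.card V = q ^ 2 + q + 1 ∧
      (∃ 𝓛₁ 𝓛₂ : Set (Finset V),
        X.IsCopyOfPG (GaloisField p m) 𝓛₁ ∧
        X.IsCopyOfPG (GaloisField p m) 𝓛₂ ∧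
        𝓛₁.ncard = q ^ 2 + q + 1 ∧
        𝓛₂.ncard = q ^ 2 + q + 1 ∧
        Disjoint 𝓛₁ 𝓛₂ ∧
        X.facets = 𝓛₁ ∪ 𝓛₂) ∧
      (∀ s ∈ X.faces, ∃ t ∈ X.facets, s ⊆ t) ∧
      (∃ ρ : Multiplicative (ZMod (q ^ 2 + q + 1)) →* X.aut, X.ActsFreely ρ) ∧
      X.TwoNeighborly := by
  have hK : Nat.card (GaloisField p m) = q := hq ▸ GaloisField.card p m hm.ne'
  have hq1 : 1 < q := hK ▸ Finite.one_lt_card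
  obtain ⟨d, hd, e, f, hef⟩ := exists_perfectDifference_PG (GaloisField p m) hK
  have hι : 2 < Fintype.card (Fin (q + 1)) := by rw [Fintype.card_fin]; omega
  have hι' : 1 < Fintype.card (Fin (q + 1)) := by omega
  have hcard : Fintype.card (ZMod (q ^ 2 + q + 1)) = q ^ 2 + q + 1 := ZMod.card _
  have hpc : PathConnectedSpace (differenceComplex d).realization :=
    AbstractSimplicialComplex.pathConnectedSpace_realization (twoNeighborly_differenceComplex hd)
  refine ⟨ZMod (q ^ 2 + q + 1), inferInstance, differenceComplex d, inferInstance,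
    hasDimension_differenceComplex hd (Fintype.card_fin _),
    DifferenceComplex.nonempty_fundamentalGroup_mulEquiv hd hpc, hcard,
    ⟨Set.range (translateSet d), Set.range (translateSet (-d)),
      isCopyOfPG_range_translateSet hd hι' _ e f hef,
      -- Negating the labels of both points and lines carries the first copy of the plane to the
      -- second.
      isCopyOfPG_range_translateSet hd.neg hι' _ (e.trans (Equiv.neg _)) (f.trans (Equiv.neg _))
        fun p l => (hef p l).trans neg_mem_translateSet_neg.symm,
      (ncard_range_translateSet hd hι').trans hcard,
      (ncard_range_translateSet hd.neg hι').trans hcard,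
      disjoint_range_translateSet hd hι, facets_differenceComplex hd⟩, ?_,
    ⟨translationHom d, actsFreely_translationHom hd⟩, twoNeighborly_differenceComplex hd⟩
  rw [facets_differenceComplex hd]
  exact fun s hs => exists_subset_of_mem_faces hs
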